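/- Let $\Omega\subset\mathbb{C}^n$ be a bounded domain (a nonempty connected open set). Let $K_\Omega(z)=K_\Omega(z,z)$ be its Bergman kernel function on the diagonal, where $K_\Omega(z,w)$ is the reproducing kernel of the space of square-integrable holomorphic functions on $\Omega$ with respect to Lebesgue measure. Let $$\omega_{\mathrm B}=dd^c\log K_\Omega=i\,g_{\alpha\bar\beta}\,dz^\alpha\wedge dz^{\bar\beta},\qquad g_{\alpha\bar\beta}=\frac{\partial^2\log K_\Omega}{\partial z^\alpha\,\partial z^{\bar\beta}},$$ be its Bergman metric, where $d^c=\frac{i}{2}(\bar\partial-\partial)$. Suppose that the length of $d\log K_\Omega$ with respect to $\omega_{\mathrm B}$ is bounded, i.e. there is a constant $C>0$ with $$\|d\log K_\Omega\|^2_{\omega_{\mathrm B}}=\frac{\partial\log K_\Omega}{\partial z^\alpha}\,\frac{\partial\log K_\Omega}{\partial z^{\bar\beta}}\,g^{\alpha\bar\beta}<C^2\quad\text{on }\Omega,$$ where repeated indices are summed and $(g^{\alpha\bar\beta})$ is the inverse of $(g_{\alpha\bar\beta})$, normalised by $g^{\alpha\bar\beta}g_{\gamma\bar\beta}=\delta^\alpha_\gamma$.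 For $f=(f^1,\dots,f^n)$ in the group $\mathrm{Aut}(\Omega)$ of biholomorphic self-maps of $\Omega$, let $J_f=\det(\partial f^\alpha/\partial z^\beta)$. Then for every compact subset $K$ of $\Omega$ the collection $$\mathcal{F}_K=\left\{\frac{J_f}{J_f(p)} : f\in\mathrm{Aut}(\Omega),\ p\in K\right\}$$ is a normal family of holomorphic functions on $\Omega$, i.e. every sequence in $\mathcal{F}_K$ has a subsequence converging locally uniformly on $\Omega$. Moreover, the limit of any sequence in $\mathcal{F}_K$ that converges locally uniformly on $\Omega$ is a nowhere vanishing holomorphic function on $\Omega$. -/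

import Mathlib

open Set Filter Topology MeasureTheory

noncomputable section

namespace BergmanScaling

/-- Complex `n`-space. Its `volume` is Lebesgue measure (the product of the Lebesgue measures of
the coordinate planes); its norm enters only through the topology and boundedness. -/
abbrev Cn (n : ℕ) : Type := Fin n → ℂ

variable {n : ℕ}

/-- The Bergman space `A²(Ω)`: holomorphic functions on `Ω` that are square integrable on `Ω`. -/
def bergmanSpace (Ω : Set (Cn n)) : Set (Cn n → ℂ) :=
  {f | DifferentiableOn ℂ f Ω ∧ MemLp f 2 (volume.restrict Ω)}

/-- `k` is the reproducing kernel of `A²(Ω)`: for every `w ∈ Ω`, the function `k(·, w)` lies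
in `A²(Ω)` and `f(w) = ∫_Ω f(z) conj(k(z, w)) dV(z)` for every `f ∈ A²(Ω)`. -/
def IsBergmanKernel (Ω : Set (Cn n)) (k : Cn n → Cn n → ℂ) : Prop :=
  ∀ w ∈ Ω, (fun z => k z w) ∈ bergmanSpace Ω ∧
    ∀ f ∈ bergmanSpace Ω, f w = ∫ z in Ω, f z * star (k z w)

/-- The reproducing kernel is unique on `Ω × Ω`. -/
theorem IsBergmanKernel.unique {Ω : Set (Cn n)} {k l : Cn n → Cn n → ℂ}
    (hk : IsBergmanKernel Ω k) (hl : IsBergmanKernel Ω l) {z w : Cn n}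
    (hz : z ∈ Ω) (hw : w ∈ Ω) : k z w = l z w := by
  have e1 := (hk z hz).2 _ (hl w hw).1
  have e2 := (hl w hw).2 _ (hk z hz).1
  have e3 := (hk z hz).2 _ (hk w hw).1
  have e4 := (hk w hw).2 _ (hk z hz).1
  have s1 : star (k w z) = l z w := by
    rw [e1, e2, ← starRingEnd_apply, ← integral_conj]
    simp [mul_comm]
  have s2 : star (k w z) = k z w := by
    rw [e3, e4, ← starRingEnd_apply, ← integral_conj]
    simp [mul_comm]
  rw [← s2, s1]

open Classical in
/-- The Bergman kernel `K_Ω(z, w)`: the reproducing kernel of `A²(Ω)`. -/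
def bergmanKernel (Ω : Set (Cn n)) : Cn n → Cn n → ℂ :=
  if h : ∃ k, IsBergmanKernel Ω k then h.choose else 0

/-- The Bergman kernel function on the diagonal, `K_Ω(z) = K_Ω(z, z)`, a real number. -/
def bergmanDiag (Ω : Set (Cn n)) (z : Cn n) : ℝ := (bergmanKernel Ω z z).re

/-- The Wirtinger derivative `∂u/∂z^α = (∂u/∂x^α - i ∂u/∂y^α) / 2`. -/
def dz (α : Fin n) (u : Cn n → ℂ) (z : Cn n) : ℂ :=
  (fderiv ℝ u z (Pi.single α 1) - Complex.I * fderiv ℝ u z (Pi.single α Complex.I)) / 2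

/-- The Wirtinger derivative `∂u/∂z̄^α = (∂u/∂x^α + i ∂u/∂y^α) / 2`. -/
def dzbar (α : Fin n) (u : Cn n → ℂ) (z : Cn n) : ℂ :=
  (fderiv ℝ u z (Pi.single α 1) + Complex.I * fderiv ℝ u z (Pi.single α Complex.I)) / 2

/-- `log K_Ω`, regarded as a complex-valued function. -/
def logBergman (Ω : Set (Cn n)) (z : Cn n) : ℂ := (Real.log (bergmanDiag Ω z) : ℂ)

/-- The coefficient matrix `g_{αβ̄} = ∂² log K_Ω / ∂z^α ∂z̄^β` of the Bergman metric
`dd^c log K_Ω = i ∂∂̄ log K_Ω = i g_{αβ̄} dz^α ∧ dz̄^β`, where `d^c = (i/2)(∂̄ - ∂)`. -/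
def bergmanMetric (Ω : Set (Cn n)) (z : Cn n) : Matrix (Fin n) (Fin n) ℂ :=
  Matrix.of fun α β => dz α (dzbar β (logBergman Ω)) z

/-- The squared length of `d log K_Ω` with respect to the Bergman metric,
`∑ g^{αβ̄} (∂ log K_Ω / ∂z^α) (∂ log K_Ω / ∂z̄^β)`. The inverse metric is normalised by
`∑_β g^{αβ̄} g_{γβ̄} = δ^α_γ`, so that `g^{αβ̄}` is the `(β, α)` entry of the inverse of the
matrix `(g_{αβ̄})`. The sum is a real number. -/
def bergmanLengthSq (Ω : Set (Cn n)) (z : Cn n) : ℝ :=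
  (∑ α, ∑ β, dz α (logBergman Ω) z * dzbar β (logBergman Ω) z
    * (bergmanMetric Ω z)⁻¹ β α).re

/-- `f` restricts to a holomorphic automorphism of `Ω`: a holomorphic self-map of `Ω` with a
holomorphic inverse. The values of `f` off `Ω` are irrelevant. -/
def IsAutomorphism (Ω : Set (Cn n)) (f : Cn n → Cn n) : Prop :=
  DifferentiableOn ℂ f Ω ∧ MapsTo f Ω Ω ∧
    ∃ g : Cn n → Cn n, DifferentiableOn ℂ g Ω ∧ MapsTo g Ω Ω ∧ InvOn g f Ω Ω

/-- The holomorphic Jacobian determinant `J_f = det (∂f^α / ∂z^β)`. -/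
def jacobian (f : Cn n → Cn n) (z : Cn n) : ℂ :=
  (Matrix.of fun α β : Fin n => fderiv ℂ f z (Pi.single β 1) α).det

/-- The family `{J_f / J_f(p) : f ∈ Aut(Ω), p ∈ K}`. -/
def jacobianFamily (Ω K : Set (Cn n)) : Set (Cn n → ℂ) :=
  {h | ∃ f, IsAutomorphism Ω f ∧ ∃ p ∈ K, h = fun z => jacobian f z / jacobian f p}

/-- A normal family of holomorphic functions on `Ω`: every sequence in the family has a
subsequence converging locally uniformly on `Ω` to a (finite-valued) function. -/
def IsNormalFamily (Ω : Set (Cn n)) (F : Set (Cn n → ℂ)) : Prop :=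
  (∀ h ∈ F, DifferentiableOn ℂ h Ω) ∧
    ∀ u : ℕ → Cn n → ℂ, (∀ j, u j ∈ F) →
      ∃ φ : ℕ → ℕ, StrictMono φ ∧
        ∃ h : Cn n → ℂ, TendstoLocallyUniformlyOn (fun j => u (φ j)) h atTop Ω

end BergmanScaling

end

noncomputable section

namespace BergmanScaling

/-! ### Cauchy estimates, Weierstrass' and Montel's theorems for maps between normed spaces. -/

section SeveralComplexVariables

open Metric

/-! Point evaluations on the Bergman space, moved into `L²` by Riesz duality followed by
conjugation, give a holomorphic map `e` from `Ω` to a Hilbert space with `‖e‖² = K_Ω`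
(`exists_bergman_embedding`). Then `∂ log K_Ω(v) = ⟨e, de(v)⟩ / ‖e‖²`, and the Bergman length of `v`
is `|v|_g = ‖de(v)^⊥‖ / ‖e‖`, where `⊥` denotes the part orthogonal to `e`. By Cauchy-Schwarz for
`g`, the hypothesis says `|∂ log K_Ω(v)| ≤ C |v|_g` for every `v` (`norm_logNormDeriv_le`).

For an automorphism `f`, the transformation law `K_Ω = (K_Ω ∘ f) |J_f|²` shows that `J_f · (e ∘ f)`
is a second holomorphic map inducing `K_Ω`. Comparing it with `e` gives the invariance of `g` under
`f` and `dJ_f(v) / J_f = ∂ log K_Ω(v) - (∂ log K_Ω)_{f(z)}(df(v))` at `z`. Both terms on the right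
are at most `C |v|_g`, so `d log J_f` is bounded by `2C` in the Bergman metric, hence locally in the
Euclidean one, with constants independent of `f` (`exists_norm_fderiv_jacobian_le`).

Integrating along segments gives a Harnack inequality for `|J_f|`. Connectedness of `Ω` and
compactness of `K` then bound `|J_f / J_f(p)|` above and away from zero near each point, uniformly
in `f` and `p` (`exists_norm_jacobian_le_of_isCompact`). The upper bound and Montel's theorem give
normality; the lower bound passes to limits and excludes zeros. -/

theorem mapsTo_closedBall_of_norm_le {E F : Type*} [NormedAddCommGroup E] [NormedAddCommGroup F]
    {f : E → F} {c : E} {R M : ℝ} (hR : 0 < R)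
    (hM : ∀ z ∈ ball c R, ‖f z‖ ≤ M) : MapsTo f (ball c R) (closedBall (f c) (2 * M)) := by
  intro z hz
  rw [mem_closedBall, dist_eq_norm]
  have h1 := hM z hz
  have h2 := hM c (mem_ball_self hR)
  linarith [norm_sub_le (f z) (f c)]

variable {E F : Type*} [NormedAddCommGroup E] [NormedSpace ℂ E]
  [NormedAddCommGroup F] [NormedSpace ℂ F]

/-- Cauchy's estimate for the derivative. -/
theorem norm_fderiv_le_of_norm_le {f : E → F} {c : E} {R M : ℝ} (hR : 0 < R)
    (hd : DifferentiableOn ℂ f (ball c R)) (hM : ∀ z ∈ ball c R, ‖f z‖ ≤ M) :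
    ‖fderiv ℂ f c‖ ≤ 2 * M / R :=
  Complex.norm_fderiv_le_div_of_mapsTo_ball hd (mapsTo_closedBall_of_norm_le hR hM) hR

/-- The quadratic bound for the first order Taylor remainder. -/
theorem norm_taylor_remainder_le {f : E → F} {c z : E} {R M : ℝ} (hR : 0 < R)
    (hd : DifferentiableOn ℂ f (ball c R)) (hM : ∀ z ∈ ball c R, ‖f z‖ ≤ M)
    (hz : z ∈ ball c R) :
    ‖f z - f c - fderiv ℂ f c (z - c)‖ ≤ 4 * M * (‖z - c‖ / R) ^ 2 := by
  have hfd := norm_fderiv_le_of_norm_le hR hd hM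
  have hdc : DifferentiableAt ℂ f c := hd.differentiableAt (ball_mem_nhds c hR)
  -- Removing the linear part makes `g - g c` vanish beyond first order at `c`, so the higher-order
  -- Schwarz lemma applies; `f - f c` and the linear part each contribute `2 * M` to the radius `4 *
  -- M`.
  set g : E → F := fun w => f w - fderiv ℂ f c (w - c) with hg
  have hgc : g c = f c := by simp [hg]
  have hM0 : 0 ≤ M := (norm_nonneg _).trans (hM c (mem_ball_self hR))
  have hgd : DifferentiableOn ℂ g (ball c R) :=
    hd.sub (Differentiable.differentiableOn (by fun_prop))
  have hmaps : MapsTo g (ball c R) (closedBall (g c) (4 * M)) := by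
    intro w hw
    have h1 := mapsTo_closedBall_of_norm_le hR hM hw
    rw [mem_closedBall, dist_eq_norm] at h1 ⊢
    have h2 : ‖fderiv ℂ f c (w - c)‖ ≤ 2 * M := by
      refine ((fderiv ℂ f c).le_opNorm _).trans ?_
      have hw' : ‖w - c‖ ≤ R := by
        rw [mem_ball, dist_eq_norm] at hw
        exact hw.le
      calc ‖fderiv ℂ f c‖ * ‖w - c‖ ≤ 2 * M / R * R := by gcongr
        _ = 2 * M := by field_simp
    have h3 : g w - g c = (f w - f c) - fderiv ℂ f c (w - c) := by
      rw [hgc]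
      simp only [hg]
      abel
    rw [h3]
    linarith [norm_sub_le (f w - f c) (fderiv ℂ f c (w - c))]
  have hlit : (g · - g c) =o[𝓝 c] (fun w ↦ ‖w - c‖ ^ 1) := by
    have h := hdc.hasFDerivAt.isLittleO
    simp only [pow_one]
    refine h.norm_right.congr_left fun w => ?_
    rw [hgc]
    simp only [hg]
    abel
  have key := Complex.dist_le_mul_div_pow_of_mapsTo_ball_of_isLittleO hgd hmaps hlit hz
  rw [dist_eq_norm, dist_eq_norm, hgc] at key
  have h3 : f z - f c - fderiv ℂ f c (z - c) = g z - f c := by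
    simp only [hg]
    abel
  rw [h3]
  simpa using key

/-- Weierstrass' theorem: a locally uniform limit of holomorphic maps is holomorphic. -/
theorem differentiableOn_of_tendstoLocallyUniformlyOn [ProperSpace E] [CompleteSpace F]
    {ι : Type*} {φ : Filter ι}
    [φ.NeBot] {f : ι → E → F} {g : E → F} {U : Set E} (hU : IsOpen U)
    (hf : TendstoLocallyUniformlyOn f g φ U) (hd : ∀ᶠ i in φ, DifferentiableOn ℂ (f i) U) :
    DifferentiableOn ℂ g U := by
  intro x hx
  obtain ⟨R, hR, hRU⟩ := nhds_basis_closedBall.mem_iff.1 (hU.mem_nhds hx)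
  have hunif : TendstoUniformlyOn f g φ (closedBall x R) :=
    (tendstoLocallyUniformlyOn_iff_forall_isCompact hU).1 hf _ hRU (isCompact_closedBall x R)
  have hsub : ∀ y ∈ ball x (R / 2), ball y (R / 2) ⊆ closedBall x R := by
    intro y hy w hw
    rw [mem_ball] at hy hw
    rw [mem_closedBall]
    linarith [dist_triangle w y x]
  have hcauchy : UniformCauchySeqOn (fun i => fderiv ℂ (f i)) φ (ball x (R / 2)) := by
    intro u hu
    obtain ⟨ε, hε, hεu⟩ := Metric.mem_uniformity_dist.1 hu
    -- Cauchy's estimate on balls of radius `R / 2` turns this bound on differences of the maps into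
    -- `ε / 2` for their derivatives.
    have hδ : 0 < ε * R / 8 := by positivity
    have hc := hunif.uniformCauchySeqOn _ (Metric.dist_mem_uniformity hδ)
    filter_upwards [hc, hd.prod_mk hd] with m hm hdm y hy
    have hdi := (hdm.1.mono hRU).mono (hsub y hy)
    have hdj := (hdm.2.mono hRU).mono (hsub y hy)
    have hy' : ball y (R / 2) ∈ 𝓝 y := ball_mem_nhds y (by positivity)
    apply hεu
    rw [dist_eq_norm]
    have heq : fderiv ℂ (f m.1) y - fderiv ℂ (f m.2) y = fderiv ℂ (f m.1 - f m.2) y :=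
      (fderiv_sub (hdi.differentiableAt hy') (hdj.differentiableAt hy')).symm
    rw [heq]
    refine (norm_fderiv_le_of_norm_le (M := ε * R / 8) (R := R / 2) (by positivity)
      (hdi.sub hdj) ?_).trans_lt ?_
    · intro z hz
      have := hm z (hsub y hy hz)
      simp only [dist_eq_norm] at this
      exact this.le
    · field_simp
      norm_num
  have hlim : ∀ y ∈ ball x (R / 2), ∃ L, Tendsto (fun i => fderiv ℂ (f i) y) φ (𝓝 L) :=
    fun y hy => cauchy_iff_exists_le_nhds.1 (hcauchy.cauchy_map hy)
  choose! g' hg' using hlim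
  have hunif' := hcauchy.tendstoUniformlyOn_of_tendsto hg'
  have hxb : ball x (R / 2) ∈ 𝓝 x := ball_mem_nhds x (by positivity)
  refine (hasFDerivAt_of_tendstoUniformlyOnFilter (𝕜 := ℂ) (f := f) (g := g)
    (f' := fun i => fderiv ℂ (f i)) (g' := g') (l := φ) ?_ ?_
    ?_).differentiableAt.differentiableWithinAt
  · exact hunif'.tendstoUniformlyOnFilter.mono_right (le_principal_iff.2 hxb)
  · filter_upwards [hd.prod_mk hxb] with m hm
    exact (hm.1.differentiableAt (hU.mem_nhds (hRU
      (ball_subset_closedBall (ball_subset_ball (by linarith) hm.2))))).hasFDerivAt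
  · filter_upwards [hU.mem_nhds hx] with y hy using hf.tendsto_at hy

/-- The directional derivatives of a holomorphic map are holomorphic. -/
theorem differentiableOn_fderiv_apply [ProperSpace E] [CompleteSpace F] {f : E → F} {U : Set E}
    (hU : IsOpen U) (hf : DifferentiableOn ℂ f U) (v : E) : DifferentiableOn ℂ (fun z => fderiv ℂ f z v) U := by
  intro x hx
  obtain ⟨R, hR, hRU⟩ := nhds_basis_closedBall.mem_iff.1 (hU.mem_nhds hx)
  obtain ⟨M, hM⟩ := (isCompact_closedBall x R).exists_bound_of_continuousOn
    (hf.continuousOn.mono hRU)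
  have hsub : ∀ y ∈ ball x (R / 2), ball y (R / 2) ⊆ closedBall x R := by
    intro y hy w hw
    rw [mem_ball] at hy hw
    rw [mem_closedBall]
    linarith [dist_triangle w y x]
  -- Difference quotients with step `1 / (j + 1)`. The Taylor remainder makes them converge at rate
  -- `O(1 / (j + 1))`, uniformly near `x`, so Weierstrass' theorem applies.
  let G : ℕ → E → F := fun j y =>
    ((j : ℂ) + 1) • (f (y + ((j : ℂ) + 1)⁻¹ • v) - f y)
  have hnorm : ∀ j : ℕ, ‖((j : ℂ) + 1)⁻¹‖ = 1 / ((j : ℝ) + 1) := by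
    intro j
    rw [norm_inv, ← Nat.cast_succ, Complex.norm_natCast]
    push_cast
    ring
  have hsmall : Tendsto (fun j : ℕ => ‖((j : ℂ) + 1)⁻¹ • v‖) atTop (𝓝 0) := by
    have h := (tendsto_one_div_add_atTop_nhds_zero_nat (𝕜 := ℝ)).mul_const ‖v‖
    simpa only [norm_smul, hnorm, zero_mul] using h
  have hev : ∀ᶠ j : ℕ in atTop, ‖((j : ℂ) + 1)⁻¹ • v‖ < R / 2 :=
    hsmall.eventually (gt_mem_nhds (by positivity))
  have hmem : ∀ j : ℕ, ‖((j : ℂ) + 1)⁻¹ • v‖ < R / 2 → ∀ y,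
      y + ((j : ℂ) + 1)⁻¹ • v ∈ ball y (R / 2) := by
    intro j hj y
    simpa [dist_eq_norm] using hj
  have hlim : TendstoUniformlyOn G (fun z => fderiv ℂ f z v) atTop (ball x (R / 2)) := by
    rw [Metric.tendstoUniformlyOn_iff]
    intro ε hε
    have hto : Tendsto (fun j : ℕ => 4 * M * (‖v‖ / (R / 2)) ^ 2 * (1 / ((j : ℝ) + 1)))
        atTop (𝓝 0) := by
      simpa using (tendsto_one_div_add_atTop_nhds_zero_nat (𝕜 := ℝ)).const_mul
        (4 * M * (‖v‖ / (R / 2)) ^ 2)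
    filter_upwards [hev, hto.eventually (gt_mem_nhds hε)] with j hj hjε y hy
    have hT := norm_taylor_remainder_le (R := R / 2) (M := M) (by positivity)
      ((hf.mono hRU).mono (hsub y hy)) (fun z hz => hM z (hsub y hy hz)) (hmem j hj y)
    have hj0 : ((j : ℂ) + 1) ≠ 0 := Nat.cast_add_one_ne_zero j
    have heq : G j y - fderiv ℂ f y v = ((j : ℂ) + 1) •
        (f (y + ((j : ℂ) + 1)⁻¹ • v) - f y -
          fderiv ℂ f y (y + ((j : ℂ) + 1)⁻¹ • v - y)) := by
      simp only [G, add_sub_cancel_left, map_smul, smul_sub, smul_inv_smul₀ hj0]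
    rw [dist_comm, dist_eq_norm, heq, norm_smul]
    refine lt_of_le_of_lt (mul_le_mul_of_nonneg_left hT (norm_nonneg _)) ?_
    refine lt_of_eq_of_lt ?_ hjε
    have hn1 : ‖(j : ℂ) + 1‖ = (j : ℝ) + 1 := by
      rw [← Nat.cast_succ, Complex.norm_natCast]
      push_cast
      ring
    rw [add_sub_cancel_left, norm_smul, hnorm, hn1]
    have : (j : ℝ) + 1 ≠ 0 := by positivity
    field_simp
  have hGd : ∀ᶠ j in atTop, DifferentiableOn ℂ (G j) (ball x (R / 2)) := by
    filter_upwards [hev] with j hj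
    have h1 : DifferentiableOn ℂ (fun y => f (y + ((j : ℂ) + 1)⁻¹ • v)) (ball x (R / 2)) :=
      (hf.mono hRU).comp (Differentiable.differentiableOn (by fun_prop))
        fun y hy => hsub y hy (hmem j hj y)
    exact (h1.sub (hf.mono fun y hy => hRU (hsub y hy (mem_ball_self (by positivity))))).const_smul
      _
  exact ((differentiableOn_of_tendstoLocallyUniformlyOn isOpen_ball
    hlim.tendstoLocallyUniformlyOn hGd).differentiableAt
      (ball_mem_nhds x (by positivity))).differentiableWithinAt

/-- Montel's theorem: a locally bounded sequence of holomorphic maps has a locally uniformly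
convergent subsequence. -/
theorem exists_subseq_tendstoLocallyUniformlyOn [ProperSpace E] [ProperSpace F] {U : Set E}
    (hU : IsOpen U) {f : ℕ → E → F} (hf : ∀ j, DifferentiableOn ℂ (f j) U)
    (hb : ∀ x ∈ U, ∃ V ∈ 𝓝 x, ∃ M : ℝ, ∀ j, ∀ y ∈ V, ‖f j y‖ ≤ M) :
    ∃ φ : ℕ → ℕ, StrictMono φ ∧
      ∃ g : E → F, TendstoLocallyUniformlyOn (fun j => f (φ j)) g atTop U := by
  have hloc : ∀ x : U, ∃ r > 0, ∃ M L : ℝ, (∀ j, ‖f j x‖ ≤ M) ∧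
      ∀ j, ∀ y ∈ ball (x : E) r, ∀ z ∈ ball (x : E) r,
        ‖f j y - f j z‖ ≤ L * ‖y - z‖ := by
    rintro ⟨x, hx⟩
    obtain ⟨V, hV, M, hM⟩ := hb x hx
    obtain ⟨R, hR, hRV⟩ := Metric.mem_nhds_iff.1 (inter_mem hV (hU.mem_nhds hx))
    have hsub : ∀ y ∈ ball x (R / 2), ball y (R / 2) ⊆ ball x R := by
      intro y hy w hw
      rw [mem_ball] at hy hw ⊢
      linarith [dist_triangle w y x]
    have hhalf : ball x (R / 2) ⊆ ball x R := ball_subset_ball (by linarith)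
    refine ⟨R / 2, by positivity, M, 2 * M / (R / 2),
      fun j => hM j x (hRV (mem_ball_self hR)).1, fun j y hy z hz => ?_⟩
    refine (convex_ball x (R / 2)).norm_image_sub_le_of_norm_fderiv_le (𝕜 := ℂ)
      (fun w hw => (hf j).differentiableAt (hU.mem_nhds (hRV (hhalf hw)).2))
      (fun w hw => ?_) hz hy
    exact norm_fderiv_le_of_norm_le (by positivity)
      ((hf j).mono fun a ha => (hRV (hsub w hw ha)).2)
      fun a ha => hM j a (hRV (hsub w hw ha)).1
  choose r hr M L hM hL using hloc
  have : LocallyCompactSpace U := hU.locallyCompactSpace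
  -- The pointwise and local Lipschitz bounds shared by all `f j`. They force equicontinuity, so
  -- Arzelà-Ascoli makes this set compact in the topology of locally uniform convergence.
  let S : Set C(U, F) := {g | (∀ x, ‖g x‖ ≤ M x) ∧
    ∀ x y z : U, (y : E) ∈ ball (x : E) (r x) → (z : E) ∈ ball (x : E) (r x) →
      ‖g y - g z‖ ≤ L x * ‖(y : E) - z‖}
  have hequi : ∀ (A : Set (U → F)), (∀ g ∈ A, ∀ x y z : U, (y : E) ∈ ball (x : E) (r x) →
      (z : E) ∈ ball (x : E) (r x) → ‖g y - g z‖ ≤ L x * ‖(y : E) - z‖) →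
      Equicontinuous ((↑) : A → U → F) := by
    intro A hA x
    refine Metric.equicontinuousAt_of_continuity_modulus
      (fun y : U => L x * ‖(x : E) - y‖) ?_ _ ?_
    · have : Continuous fun y : U => L x * ‖(x : E) - y‖ := by fun_prop
      simpa using this.tendsto x
    · have : ∀ᶠ y : U in 𝓝 x, (y : E) ∈ ball (x : E) (r x) :=
        continuous_subtype_val.continuousAt (ball_mem_nhds _ (hr x))
      filter_upwards [this] with y hy g
      rw [dist_eq_norm]
      exact hA g.1 g.2 x x y (mem_ball_self (hr x)) hy
  have hScomp : IsCompact S := by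
    refine ArzelaAscoli.isCompact_of_equicontinuous S ?_ ?_
    -- The Lipschitz bounds already imply continuity, so the image in the product is cut out by
    -- closed pointwise conditions alone.
    · have himg : ContinuousMap.toFun '' S = {g : U → F | (∀ x, ‖g x‖ ≤ M x) ∧
          ∀ x y z : U, (y : E) ∈ ball (x : E) (r x) → (z : E) ∈ ball (x : E) (r x) →
            ‖g y - g z‖ ≤ L x * ‖(y : E) - z‖} := by
        ext g
        constructor
        · rintro ⟨g, hg, rfl⟩
          exact hg
        · intro hg
          have hc : Continuous g :=
            (hequi {g} (by rintro _ rfl; exact hg.2)).continuous ⟨g, rfl⟩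
          exact ⟨⟨g, hc⟩, hg, rfl⟩
      rw [himg]
      refine (isCompact_univ_pi fun x => isCompact_closedBall (0 : F) (M x)).of_isClosed_subset
        ?_ ?_
      · simp only [ofPred_and, ofPred_forall]
        refine (isClosed_iInter fun x => isClosed_le (by fun_prop) (by fun_prop)).inter ?_
        refine isClosed_iInter fun x => isClosed_iInter fun y => isClosed_iInter fun z =>
          isClosed_iInter fun _ => isClosed_iInter fun _ => isClosed_le (by fun_prop) (by fun_prop)
      · intro g hg x _
        simpa using hg.1 x
    · have := hequi (DFunLike.coe '' S) (by rintro _ ⟨g, hg, rfl⟩; exact hg.2)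
      exact this.comp fun g : S => ⟨g.1, g.1, g.2, rfl⟩
  have hSigma : SigmaCompactSpace U := inferInstance
  let u : ℕ → C(U, F) := fun j => ⟨U.domRestrict (f j), (hf j).continuousOn.domRestrict⟩
  have hu : ∀ j, u j ∈ S := fun j => ⟨fun x => hM x j, fun x y z hy hz => hL x j y hy z hz⟩
  obtain ⟨g, -, φ, hφ, hg⟩ := hScomp.tendsto_subseq hu
  refine ⟨φ, hφ, Function.extend (↑) g 0, ?_⟩
  rw [tendstoLocallyUniformlyOn_iff_tendstoLocallyUniformly_comp_coe]
  have h := ContinuousMap.tendsto_iff_tendstoLocallyUniformly.1 hg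
  have hext : Function.extend ((↑) : U → E) g 0 ∘ ((↑) : U → E) = g :=
    funext fun x => Subtype.val_injective.extend_apply g 0 x
  rw [hext]
  exact h

end SeveralComplexVariables

/-! ### The Bergman space as a Hilbert space, its kernel, and the map to `L²` inducing the kernel.
-/

section BergmanSpace

open Metric InnerProductSpace

variable {n : ℕ} {Ω : Set (Cn n)}

theorem measurePreserving_unit_smul {c : ℂ} (hc : ‖c‖ = 1) :
    MeasurePreserving (fun w : Cn n => c • w) := by
  have h1 : MeasurePreserving (fun a : ℂ => c * a) := by
    have h := (rotation (⟨c, mem_sphere_zero_iff_norm.2 hc⟩ : Circle)).measurePreserving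
    exact h
  exact volume_preserving_pi (fun _ : Fin n => h1)

/-- The mean value property over balls. -/
theorem setIntegral_closedBall_eq {f : Cn n → ℂ} {z : Cn n} {R : ℝ}
    (hf : DifferentiableOn ℂ f Ω) (hB : closedBall z R ⊆ Ω) :
    ∫ w in closedBall z R, f w = volume.real (closedBall z R) * f z := by
  have htrans : ∫ w in closedBall z R, f w = ∫ w in closedBall (0 : Cn n) R, f (z + w) := by
    have h := (measurePreserving_add_left (volume : Measure (Cn n)) z).setIntegral_preimage_emb
      (MeasurableEquiv.addLeft z).measurableEmbedding f (closedBall z R)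
    rw [← h]
    congr 2
    ext w
    simp [dist_eq_norm]
  have hvol : volume.real (closedBall z R) = volume.real (closedBall (0 : Cn n) R) := by
    simp only [measureReal_def, Measure.addHaar_closedBall_center]
  have hmem : ∀ (θ : ℝ) (w : Cn n), w ∈ closedBall (0 : Cn n) R →
      z + circleMap 0 1 θ • w ∈ closedBall z R := by
    intro θ w hw
    rw [mem_closedBall_zero_iff] at hw
    simpa [dist_eq_norm, norm_smul] using hw
  -- The ball, a polydisc in the sup norm, and Lebesgue measure are invariant under `w ↦ e^{iθ} w`.
  -- Averaging over `θ` reduces the claim to the one-variable mean value property on each complex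
  -- line through `z`.
  have hrot : ∀ θ : ℝ, ∫ w in closedBall (0 : Cn n) R, f (z + circleMap 0 1 θ • w) =
      ∫ w in closedBall (0 : Cn n) R, f (z + w) := by
    intro θ
    have hne : circleMap 0 1 θ ≠ 0 := circleMap_ne_center one_ne_zero
    have h := (measurePreserving_unit_smul (n := n) (c := circleMap 0 1 θ)
      (by simp)).setIntegral_preimage_emb
      (MeasurableEquiv.smul₀ (circleMap 0 1 θ) hne).measurableEmbedding
      (fun w => f (z + w)) (closedBall 0 R)
    rw [← h]
    congr 2
    ext w
    simp [norm_smul]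
  have hcirc : ∀ w ∈ closedBall (0 : Cn n) R,
      ∫ θ in (0 : ℝ)..2 * Real.pi, f (z + circleMap 0 1 θ • w) = (2 * Real.pi : ℝ) * f z := by
    intro w hw
    have hd : DiffContOnCl ℂ (fun t : ℂ => f (z + t • w)) (ball 0 |1|) := by
      have hsub : MapsTo (fun t : ℂ => z + t • w) (closedBall 0 1) (closedBall z R) := by
        intro t ht
        rw [mem_closedBall_zero_iff] at hw ht
        have : ‖t‖ * ‖w‖ ≤ 1 * R := by gcongr
        simpa [dist_eq_norm, norm_smul] using this
      have hdiff : DifferentiableOn ℂ (fun t : ℂ => f (z + t • w)) (closedBall 0 1) :=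
        hf.comp (Differentiable.differentiableOn (by fun_prop)) fun t ht => hB (hsub ht)
      rw [abs_one]
      refine ⟨hdiff.mono ball_subset_closedBall, ?_⟩
      rw [closure_ball _ one_ne_zero]
      exact hdiff.continuousOn
    have h := hd.circleAverage
    rw [Real.circleAverage_def] at h
    have h2 : (2 * Real.pi : ℝ) ≠ 0 := by positivity
    have h3 := congrArg (fun a : ℂ => (2 * Real.pi : ℝ) • a) h
    simp only [smul_inv_smul₀ h2] at h3
    simpa using h3
  have hint : Integrable (Function.uncurry fun (θ : ℝ) (w : Cn n) => f (z + circleMap 0 1 θ • w))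
      ((volume.restrict (uIoc 0 (2 * Real.pi))).prod
        (volume.restrict (closedBall (0 : Cn n) R))) := by
    rw [Measure.prod_restrict]
    have hc : ContinuousOn (Function.uncurry fun (θ : ℝ) (w : Cn n) =>
        f (z + circleMap 0 1 θ • w)) (Icc 0 (2 * Real.pi) ×ˢ closedBall (0 : Cn n) R) := by
      refine hf.continuousOn.comp (Continuous.continuousOn ?_) ?_
      · fun_prop
      · rintro ⟨θ, w⟩ ⟨-, hw⟩
        exact hB (hmem θ w hw)
    refine (hc.integrableOn_compact (isCompact_Icc.prod (isCompact_closedBall _ _))).mono_set ?_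
    refine prod_mono ?_ subset_rfl
    rw [uIoc_of_le (by positivity)]
    exact Ioc_subset_Icc_self
  have hpi : (0 : ℝ) ≤ 2 * Real.pi := by positivity
  have hswap := integral_integral_swap hint
  simp only [hrot] at hswap
  have hinner : ∫ w in closedBall (0 : Cn n) R, ∫ θ in uIoc 0 (2 * Real.pi),
      f (z + circleMap 0 1 θ • w) =
        ∫ _ in closedBall (0 : Cn n) R, ((2 * Real.pi : ℝ) : ℂ) * f z := by
    refine setIntegral_congr_fun measurableSet_closedBall fun w hw => ?_
    have h := hcirc w hw
    rwa [intervalIntegral.integral_of_le hpi, ← uIoc_of_le hpi] at h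
  rw [hinner] at hswap
  rw [setIntegral_const, setIntegral_const, uIoc_of_le hpi] at hswap
  rw [htrans, hvol]
  have h2 : ((2 * Real.pi : ℝ) : ℂ) ≠ 0 := by
    exact_mod_cast (by positivity : (2 * Real.pi : ℝ) ≠ 0)
  apply mul_left_cancel₀ h2
  have hv : volume.real (Ioc 0 (2 * Real.pi)) = 2 * Real.pi := by simp [hpi]
  rw [hv, Complex.real_smul, Complex.real_smul] at hswap
  rw [hswap]
  ring

/-- Square integrable holomorphic functions are locally bounded by their norm. -/
theorem exists_norm_le_mul_norm {z₀ : Cn n} {R : ℝ} (hR : 0 < R)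
    (hB : closedBall z₀ (2 * R) ⊆ Ω) :
    ∃ M : ℝ, 0 ≤ M ∧ ∀ (u : Lp ℂ 2 (volume.restrict Ω)) (f : Cn n → ℂ), DifferentiableOn ℂ f Ω →
      u =ᵐ[volume.restrict Ω] f → ∀ z ∈ closedBall z₀ R, ‖f z‖ ≤ M * ‖u‖ := by
  set V := volume.real (closedBall (0 : Cn n) R) with hV
  have hV0 : 0 < V :=
    ENNReal.toReal_pos (measure_closedBall_pos volume _ hR).ne' measure_closedBall_lt_top.ne
  -- By the mean value property `V * f z` is the inner product of `u` with the indicator of a ball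
  -- of volume `V`, whose `L²` norm is `V ^ (1 / 2)`; then Cauchy-Schwarz.
  refine ⟨V⁻¹ * V ^ (1 / (2 : ℝ)), by positivity, fun u f hf huf z hz => ?_⟩
  have hzB : closedBall z R ⊆ Ω := by
    intro w hw
    apply hB
    rw [mem_closedBall] at hw hz ⊢
    linarith [dist_triangle w z z₀]
  have hmeas : (volume.restrict Ω) (closedBall z R) ≠ ⊤ :=
    ((Measure.restrict_apply_le _ _).trans_lt measure_closedBall_lt_top).ne
  have hvol : volume.real (closedBall z R) = V := by
    simp only [hV, measureReal_def, Measure.addHaar_closedBall_center]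
  have h1 := L2.inner_indicatorConstLp_one (𝕜 := ℂ) measurableSet_closedBall hmeas u
  have h2 : ∫ x in closedBall z R, u x ∂(volume.restrict Ω) = V * f z := by
    rw [integral_congr_ae (ae_restrict_of_ae huf),
      Measure.restrict_restrict measurableSet_closedBall, inter_eq_left.2 hzB,
      setIntegral_closedBall_eq hf hzB, hvol]
  have h3 : ‖indicatorConstLp 2 measurableSet_closedBall hmeas (1 : ℂ)‖ = V ^ (1 / (2 : ℝ)) := by
    rw [norm_indicatorConstLp (by norm_num) (by norm_num)]
    rw [measureReal_restrict_apply measurableSet_closedBall, inter_eq_left.2 hzB, hvol]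
    simp
  have h4 := norm_inner_le_norm (𝕜 := ℂ)
    (indicatorConstLp 2 measurableSet_closedBall hmeas (1 : ℂ)) u
  rw [h1, h2, h3, norm_mul, Complex.norm_real, Real.norm_of_nonneg hV0.le] at h4
  rw [mul_assoc]
  exact (le_inv_mul_iff₀ hV0).2 h4

variable (Ω) in
/-- The Bergman space as a subspace of `L²(Ω)`. -/
def bergmanSubmodule : Submodule ℂ (Lp ℂ 2 ((volume : Measure (Cn n)).restrict Ω)) where
  carrier := {u | ∃ f : Cn n → ℂ, DifferentiableOn ℂ f Ω ∧ u =ᵐ[volume.restrict Ω] f}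
  zero_mem' := ⟨0, differentiableOn_const 0, Lp.coeFn_zero _ _ _⟩
  add_mem' := by
    rintro u v ⟨f, hf, hu⟩ ⟨g, hg, hv⟩
    exact ⟨f + g, hf.add hg, (Lp.coeFn_add u v).trans (hu.add hv)⟩
  smul_mem' := by
    rintro c u ⟨f, hf, hu⟩
    exact ⟨c • f, hf.const_smul c, (Lp.coeFn_smul c u).trans (hu.const_smul c)⟩

theorem exists_closedBall_two_mul_subset (hΩ : IsOpen Ω) {z : Cn n} (hz : z ∈ Ω) :
    ∃ R > 0, closedBall z (2 * R) ⊆ Ω := by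
  obtain ⟨R, hR, h⟩ := nhds_basis_closedBall.mem_iff.1 (hΩ.mem_nhds hz)
  exact ⟨R / 2, by positivity, by rwa [mul_div_cancel₀ R two_ne_zero]⟩

theorem eqOn_of_ae_eq (hΩ : IsOpen Ω) {f g : Cn n → ℂ} (hf : DifferentiableOn ℂ f Ω)
    (hg : DifferentiableOn ℂ g Ω) (h : f =ᵐ[volume.restrict Ω] g) : EqOn f g Ω :=
  Measure.eqOn_open_of_ae_eq h hΩ hf.continuousOn hg.continuousOn

/-- The sup bound by the `L²` norm upgrades `L²` convergence to locally uniform convergence of the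
representatives. Their limit is holomorphic by Weierstrass and agrees with the `L²` limit through a
subsequence converging almost everywhere. -/
theorem isClosed_bergmanSubmodule (hΩ : IsOpen Ω) :
    IsClosed (bergmanSubmodule Ω : Set (Lp ℂ 2 ((volume : Measure (Cn n)).restrict Ω))) := by
  refine IsSeqClosed.isClosed fun u v hu huv => ?_
  choose f hf huf using hu
  have hcauchy : ∀ z ∈ Ω, ∃ V ∈ 𝓝 z, UniformCauchySeqOn f atTop V := by
    intro z hz
    obtain ⟨R, hR, hB⟩ := exists_closedBall_two_mul_subset hΩ hz
    obtain ⟨M, hM0, hM⟩ := exists_norm_le_mul_norm hR hB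
    refine ⟨closedBall z R, closedBall_mem_nhds z hR, ?_⟩
    rw [Metric.uniformCauchySeqOn_iff]
    intro ε hε
    obtain ⟨N, hN⟩ := Metric.cauchySeq_iff.1 huv.cauchySeq (ε / (M + 1)) (by positivity)
    refine ⟨N, fun i hi j hj x hx => ?_⟩
    have h1 := hM (u i - u j) (f i - f j) ((hf i).sub (hf j))
      ((Lp.coeFn_sub _ _).trans ((huf i).sub (huf j))) x hx
    have h2 := hN i hi j hj
    rw [dist_eq_norm] at h2 ⊢
    refine h1.trans_lt ?_
    rw [lt_div_iff₀ (by positivity)] at h2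
    nlinarith [norm_nonneg (u i - u j)]
  have hlim : ∀ z ∈ Ω, ∃ a, Tendsto (fun i => f i z) atTop (𝓝 a) := by
    intro z hz
    obtain ⟨V, hV, hc⟩ := hcauchy z hz
    exact cauchySeq_tendsto_of_complete (hc.cauchySeq (mem_of_mem_nhds hV))
  choose! g hg using hlim
  have hloc : TendstoLocallyUniformlyOn f g atTop Ω := by
    refine tendstoLocallyUniformlyOn_of_forall_exists_nhds fun z hz => ?_
    obtain ⟨V, hV, hc⟩ := hcauchy z hz
    exact ⟨V ∩ Ω, inter_mem (mem_nhdsWithin_of_mem_nhds hV) self_mem_nhdsWithin,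
      (hc.mono inter_subset_left).tendstoUniformlyOn_of_tendsto fun x hx => hg x hx.2⟩
  refine ⟨g, differentiableOn_of_tendstoLocallyUniformlyOn hΩ hloc (Eventually.of_forall hf), ?_⟩
  obtain ⟨φ, hφ, hae⟩ := (tendstoInMeasure_of_tendsto_Lp huv).exists_seq_tendsto_ae
  have hae' : ∀ᵐ x ∂(volume.restrict Ω), ∀ i, u i x = f i x := ae_all_iff.2 huf
  filter_upwards [hae, hae', ae_restrict_mem hΩ.measurableSet] with x h1 h2 hx
  simp only [h2] at h1
  exact tendsto_nhds_unique h1 ((hg x hx).comp hφ.tendsto_atTop)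

/-- The holomorphic representative of an element of the Bergman space. -/
def holoRep (u : bergmanSubmodule Ω) : Cn n → ℂ := u.2.choose

theorem differentiableOn_holoRep (u : bergmanSubmodule Ω) : DifferentiableOn ℂ (holoRep u) Ω :=
  u.2.choose_spec.1

theorem coeFn_ae_eq_holoRep (u : bergmanSubmodule Ω) :
    (u : Lp ℂ 2 (volume.restrict Ω)) =ᵐ[volume.restrict Ω] holoRep u :=
  u.2.choose_spec.2

theorem holoRep_eqOn (hΩ : IsOpen Ω) (u : bergmanSubmodule Ω) {f : Cn n → ℂ}
    (hf : DifferentiableOn ℂ f Ω) (h : (u : Lp ℂ 2 (volume.restrict Ω)) =ᵐ[volume.restrict Ω] f) :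
    EqOn (holoRep u) f Ω :=
  eqOn_of_ae_eq hΩ (differentiableOn_holoRep u) hf ((coeFn_ae_eq_holoRep u).symm.trans h)

theorem holoRep_add (hΩ : IsOpen Ω) (u v : bergmanSubmodule Ω) :
    EqOn (holoRep (u + v)) (holoRep u + holoRep v) Ω :=
  holoRep_eqOn hΩ _ ((differentiableOn_holoRep u).add (differentiableOn_holoRep v))
    ((Lp.coeFn_add _ _).trans ((coeFn_ae_eq_holoRep u).add (coeFn_ae_eq_holoRep v)))

theorem holoRep_smul (hΩ : IsOpen Ω) (c : ℂ) (u : bergmanSubmodule Ω) :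
    EqOn (holoRep (c • u)) (c • holoRep u) Ω :=
  holoRep_eqOn hΩ _ ((differentiableOn_holoRep u).const_smul c)
    ((Lp.coeFn_smul _ _).trans ((coeFn_ae_eq_holoRep u).const_smul c))

/-- In a normed space of holomorphic functions with locally bounded evaluations, the evaluation
functionals depend holomorphically on the point. -/
theorem exists_evaluation {H : Type*} [NormedAddCommGroup H] [NormedSpace ℂ H] (hΩ : IsOpen Ω)
    {ρ : H → Cn n → ℂ} (hd : ∀ u, DifferentiableOn ℂ (ρ u) Ω)
    (hadd : ∀ u v, EqOn (ρ (u + v)) (ρ u + ρ v) Ω)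
    (hsmul : ∀ (c : ℂ) u, EqOn (ρ (c • u)) (c • ρ u) Ω)
    (hbound : ∀ (z : Cn n) (R : ℝ), 0 < R → closedBall z (2 * R) ⊆ Ω →
      ∃ M : ℝ, 0 ≤ M ∧ ∀ u, ∀ w ∈ closedBall z R, ‖ρ u w‖ ≤ M * ‖u‖) :
    ∃ ev : Cn n → StrongDual ℂ H, DifferentiableOn ℂ ev Ω ∧ ∀ z ∈ Ω, ∀ u, ev z u = ρ u z := by
  have hex : ∀ z ∈ Ω, ∃ L : StrongDual ℂ H, ∀ u, L u = ρ u z := by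
    intro z hz
    obtain ⟨R, hR, hB⟩ := exists_closedBall_two_mul_subset hΩ hz
    obtain ⟨M, hM0, hM⟩ := hbound z R hR hB
    refine ⟨LinearMap.mkContinuous
      { toFun := fun u => ρ u z
        map_add' := fun u v => hadd u v hz
        map_smul' := fun c u => hsmul c u hz } M fun u => ?_, fun u => rfl⟩
    exact hM u z (mem_closedBall_self hR.le)
  choose! ev hev using hex
  refine ⟨ev, fun z hz => ?_, hev⟩
  obtain ⟨R, hR, hB⟩ := exists_closedBall_two_mul_subset hΩ hz
  obtain ⟨M, hM0, hM⟩ := hbound z R hR hB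
  have hBΩ : ball z R ⊆ Ω := fun w hw => hB (ball_subset_closedBall
    (ball_subset_ball (by linarith) hw))
  have hMu : ∀ u : H, ∀ w ∈ ball z R, ‖ρ u w‖ ≤ M * ‖u‖ := fun u w hw =>
    hM u w (ball_subset_closedBall hw)
  have hda : ∀ u : H, DifferentiableAt ℂ (ρ u) z := fun u =>
    (hd u).differentiableAt (hΩ.mem_nhds hz)
  let D : Cn n →L[ℂ] StrongDual ℂ H :=
    LinearMap.mkContinuous₂ (LinearMap.mk₂ ℂ (fun h u => fderiv ℂ (ρ u) z h)
      (fun h h' u => map_add _ h h') (fun c h u => map_smul _ c h)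
      (fun h u v => by
        rw [((hadd u v).eventuallyEq_of_mem (hΩ.mem_nhds hz)).fderiv_eq,
          fderiv_add (hda u) (hda v)]
        rfl)
      (fun c h u => by
        rw [((hsmul c u).eventuallyEq_of_mem (hΩ.mem_nhds hz)).fderiv_eq,
          fderiv_const_smul (hda u)]
        rfl)) (2 * M / R) (fun h u => by
        have h1 := norm_fderiv_le_of_norm_le hR ((hd u).mono hBΩ) (hMu u)
        calc ‖fderiv ℂ (ρ u) z h‖ ≤ ‖fderiv ℂ (ρ u) z‖ * ‖h‖ :=
              (fderiv ℂ (ρ u) z).le_opNorm h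
          _ ≤ 2 * (M * ‖u‖) / R * ‖h‖ := by gcongr
          _ = 2 * M / R * ‖h‖ * ‖u‖ := by ring)
  have hD : ∀ h u, D h u = fderiv ℂ (ρ u) z h := fun h u => rfl
  -- The quadratic Taylor remainder of `ρ u` is bounded linearly in `‖u‖`, so it controls the
  -- operator norm: pointwise holomorphy becomes holomorphy in the dual norm.
  have hbig : (fun w => ev w - ev z - D (w - z)) =O[𝓝 z] fun w => ‖w - z‖ ^ 2 := by
    refine Asymptotics.IsBigO.of_bound (4 * M / R ^ 2) ?_
    filter_upwards [ball_mem_nhds z hR] with w hw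
    refine ContinuousLinearMap.opNorm_le_bound _ (by positivity) fun u => ?_
    have h := norm_taylor_remainder_le hR ((hd u).mono hBΩ) (hMu u) hw
    simp only [_root_.sub_apply, hD, hev w (hBΩ hw), hev z hz]
    refine h.trans (le_of_eq ?_)
    rw [norm_pow, norm_norm]
    ring
  have h : HasFDerivAt ev D z := .of_isLittleO
    (hbig.trans_isLittleO (Asymptotics.isLittleO_pow_sub_sub z one_lt_two))
  exact h.differentiableAt.differentiableWithinAt

theorem exists_bergman_evaluation (hΩ : IsOpen Ω) :
    ∃ ev : Cn n → StrongDual ℂ (bergmanSubmodule Ω), DifferentiableOn ℂ ev Ω ∧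
      ∀ z ∈ Ω, ∀ u, ev z u = holoRep u z := by
  refine exists_evaluation hΩ differentiableOn_holoRep (holoRep_add hΩ) (holoRep_smul hΩ) ?_
  intro z R hR hB
  obtain ⟨M, hM0, hM⟩ := exists_norm_le_mul_norm hR hB
  exact ⟨M, hM0, fun u => hM u _ (differentiableOn_holoRep u) (coeFn_ae_eq_holoRep u)⟩

/-- Riesz representation of the evaluation at `w` is exactly the reproducing property. -/
theorem exists_isBergmanKernel_of_evaluation (hΩ : IsOpen Ω) [CompleteSpace (bergmanSubmodule Ω)]
    {ev : Cn n → StrongDual ℂ (bergmanSubmodule Ω)} (hev : ∀ z ∈ Ω, ∀ u, ev z u = holoRep u z) :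
    IsBergmanKernel Ω fun z w => holoRep ((toDual ℂ (bergmanSubmodule Ω)).symm (ev w)) z := by
  intro w hw
  set κ := (toDual ℂ (bergmanSubmodule Ω)).symm (ev w) with hκ
  refine ⟨⟨differentiableOn_holoRep κ,
    (memLp_congr_ae (coeFn_ae_eq_holoRep κ)).1 (Lp.memLp _)⟩, fun f hf => ?_⟩
  have hmem : hf.2.toLp f ∈ bergmanSubmodule Ω := ⟨f, hf.1, hf.2.coeFn_toLp⟩
  have h1 : inner ℂ κ ⟨hf.2.toLp f, hmem⟩ = f w := by
    rw [hκ, toDual_symm_apply, hev w hw]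
    exact holoRep_eqOn hΩ _ hf.1 hf.2.coeFn_toLp hw
  rw [← h1, Submodule.coe_inner, L2.inner_def]
  refine integral_congr_ae ?_
  filter_upwards [coeFn_ae_eq_holoRep κ, hf.2.coeFn_toLp] with x hx1 hx2
  rw [hx1, hx2]
  rfl

theorem isBergmanKernel_bergmanKernel (hΩ : IsOpen Ω) : IsBergmanKernel Ω (bergmanKernel Ω) := by
  have : CompleteSpace (bergmanSubmodule Ω) := (isClosed_bergmanSubmodule hΩ).completeSpace_coe
  obtain ⟨ev, -, hev⟩ := exists_bergman_evaluation hΩ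
  have h : ∃ k, IsBergmanKernel Ω k := ⟨_, exists_isBergmanKernel_of_evaluation hΩ hev⟩
  rw [bergmanKernel, dif_pos h]
  exact h.choose_spec

/-- Complex conjugation on `L²`. -/
def lpConj {α : Type*} {m : MeasurableSpace α} (μ : Measure α) : Lp ℂ 2 μ →ₗᵢ⋆[ℂ] Lp ℂ 2 μ where
  toFun u := star u
  map_add' u v := by
    apply Lp.ext
    filter_upwards [Lp.coeFn_star (u + v), Lp.coeFn_star u, Lp.coeFn_star v, Lp.coeFn_add u v,
      Lp.coeFn_add (star u) (star v)] with x h1 h2 h3 h4 h5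
    rw [h1, h5, Pi.add_apply, h2, h3]
    exact (congrArg star h4).trans (star_add _ _)
  map_smul' c u := by
    apply Lp.ext
    filter_upwards [Lp.coeFn_star (c • u), Lp.coeFn_star u, Lp.coeFn_smul c u,
      Lp.coeFn_smul (starRingEnd ℂ c) (star u)] with x h1 h2 h3 h4
    rw [h1, h4]
    simp [h2, h3]
  norm_map' u := by
    have h : ∀ᵐ x ∂μ, ‖(star u : Lp ℂ 2 μ) x‖ = ‖u x‖ := by
      filter_upwards [Lp.coeFn_star u] with x h1
      rw [h1]
      simp
    rw [Lp.norm_def, Lp.norm_def]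
    congr 1
    exact eLpNorm_congr_norm_ae h

/-- Boundedness of `Ω` enters here: the constants and coordinate functions become available in the
Bergman space as test functions. -/
theorem mem_bergmanSpace_of_differentiable (hΩ : IsOpen Ω) (hb : Bornology.IsBounded Ω)
    (f : Cn n → ℂ) (hf : Differentiable ℂ f) : f ∈ bergmanSpace Ω := by
  refine ⟨hf.differentiableOn, ?_⟩
  obtain ⟨M, hM⟩ := hb.isCompact_closure.exists_bound_of_continuousOn hf.continuous.continuousOn
  have : IsFiniteMeasure ((volume : Measure (Cn n)).restrict Ω) :=
    ⟨by rw [Measure.restrict_apply_univ]; exact hb.measure_lt_top⟩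
  refine MemLp.of_bound hf.continuous.aestronglyMeasurable M ?_
  filter_upwards [ae_restrict_mem hΩ.measurableSet] with x hx using hM x (subset_closure hx)

/-- The holomorphic map to a Hilbert space that is given by the evaluation functionals of a Hilbert
space of holomorphic functions which contains the affine functions. -/
theorem exists_embedding_of_evaluation {H F : Type*} [NormedAddCommGroup H] [InnerProductSpace ℂ H]
    [CompleteSpace H] [NormedAddCommGroup F] [InnerProductSpace ℂ F] (hΩ : IsOpen Ω)
    {ρ : H → Cn n → ℂ} {ev : Cn n → StrongDual ℂ H} (hevd : DifferentiableOn ℂ ev Ω)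
    (hev : ∀ z ∈ Ω, ∀ u, ev z u = ρ u z) (ι : H →ₗᵢ⋆[ℂ] F)
    (hrep : ∀ f : Cn n → ℂ, Differentiable ℂ f → ∃ u, EqOn (ρ u) f Ω) :
    ∃ e : Cn n → F, DifferentiableOn ℂ e Ω ∧
      (∀ z ∈ Ω, ‖e z‖ ^ 2 = (ρ ((toDual ℂ H).symm (ev z)) z).re) ∧ (∀ z ∈ Ω, e z ≠ 0) ∧
      ∀ z ∈ Ω, ∀ (v : Cn n) (c : ℂ), fderiv ℂ e z v = c • e z → v = 0 := by
  -- The Riesz map is conjugate linear; composing it with the conjugate linear `ι` restores complex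
  -- linearity, which keeps the embedding holomorphic.
  let S : StrongDual ℂ H →ₗᵢ[ℂ] F := ι.comp (toDual ℂ H).symm.toLinearIsometry
  have hSnorm : ∀ z ∈ Ω, ‖S (ev z)‖ ^ 2 = (ρ ((toDual ℂ H).symm (ev z)) z).re := by
    intro z hz
    rw [S.norm_map, ← (toDual ℂ H).symm.norm_map, ← hev z hz, ← toDual_symm_apply]
    exact norm_sq_eq_re_inner (𝕜 := ℂ) _
  have hS : ∀ z ∈ Ω, ∀ v, fderiv ℂ (fun z => S.toContinuousLinearMap (ev z)) z v =
      S (fderiv ℂ ev z v) := by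
    intro z hz v
    have h : HasFDerivAt (fun z => S.toContinuousLinearMap (ev z))
        (S.toContinuousLinearMap.comp (fderiv ℂ ev z)) z :=
      HasFDerivAt.comp (g := S.toContinuousLinearMap) (f := ev) z
        S.toContinuousLinearMap.hasFDerivAt
        (hevd.differentiableAt (hΩ.mem_nhds hz)).hasFDerivAt
    rw [h.fderiv]
    rfl
  have hevf : ∀ z ∈ Ω, ∀ v, ∀ f : Cn n → ℂ, Differentiable ℂ f → ∃ u : H,
      ev z u = f z ∧ fderiv ℂ ev z v u = fderiv ℂ f z v := by
    intro z hz v f hf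
    obtain ⟨u, hu⟩ := hrep f hf
    refine ⟨u, (hev z hz u).trans (hu hz), ?_⟩
    have h1 : HasFDerivAt (fun w => ev w u)
        ((ContinuousLinearMap.apply ℂ ℂ u).comp (fderiv ℂ ev z)) z :=
      (ContinuousLinearMap.apply ℂ ℂ u).hasFDerivAt.comp z
        (hevd.differentiableAt (hΩ.mem_nhds hz)).hasFDerivAt
    have h2 : (fun w => ev w u) =ᶠ[𝓝 z] f := by
      filter_upwards [hΩ.mem_nhds hz] with w hw using (hev w hw u).trans (hu hw)
    rw [← h2.fderiv_eq, h1.fderiv]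
    rfl
  refine ⟨fun z => S.toContinuousLinearMap (ev z),
    S.toContinuousLinearMap.differentiable.comp_differentiableOn hevd,
    hSnorm, fun z hz h0 => ?_, fun z hz v c h => ?_⟩
  · obtain ⟨u, hu, -⟩ := hevf z hz 0 (fun _ => 1) (by fun_prop)
    have h0' : ev z = 0 := S.injective (h0.trans S.map_zero.symm)
    simp [h0'] at hu
  · rw [hS z hz v] at h
    have h' : fderiv ℂ ev z v = c • ev z := S.injective (by rw [map_smul]; exact h)
    -- Testing `d ev(v) = c • ev` on the constant `1` gives `c = 0`; testing it on the coordinates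
    -- then gives `v = 0`.
    have hc : c = 0 := by
      obtain ⟨u, hu1, hu2⟩ := hevf z hz v (fun _ => 1) (by fun_prop)
      rw [h', smul_apply, hu1] at hu2
      simpa using hu2
    ext i
    obtain ⟨u, hu1, hu2⟩ := hevf z hz v (fun w => w i) (by fun_prop)
    rw [h', hc, smul_apply, zero_smul] at hu2
    have h3 : fderiv ℂ (fun w : Cn n => w i) z = ContinuousLinearMap.proj i :=
      (ContinuousLinearMap.proj (R := ℂ) (φ := fun _ : Fin n => ℂ) i).fderiv
    rw [h3] at hu2
    simpa using hu2.symm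

/-- The holomorphic map to a Hilbert space that induces the Bergman kernel function; it is an
immersion modulo scalars. -/
theorem exists_bergman_embedding (hΩ : IsOpen Ω) (hb : Bornology.IsBounded Ω) :
    ∃ e : Cn n → Lp ℂ 2 ((volume : Measure (Cn n)).restrict Ω), DifferentiableOn ℂ e Ω ∧
      (∀ z ∈ Ω, ‖e z‖ ^ 2 = bergmanDiag Ω z) ∧ (∀ z ∈ Ω, e z ≠ 0) ∧
      ∀ z ∈ Ω, ∀ (v : Cn n) (c : ℂ), fderiv ℂ e z v = c • e z → v = 0 := by
  have : CompleteSpace (bergmanSubmodule Ω) := (isClosed_bergmanSubmodule hΩ).completeSpace_coe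
  obtain ⟨ev, hevd, hev⟩ := exists_bergman_evaluation hΩ
  have hrep : ∀ f : Cn n → ℂ, Differentiable ℂ f →
      ∃ u : bergmanSubmodule Ω, EqOn (holoRep u) f Ω := by
    intro f hf
    have hm := mem_bergmanSpace_of_differentiable hΩ hb f hf
    exact ⟨⟨hm.2.toLp f, f, hm.1, hm.2.coeFn_toLp⟩, holoRep_eqOn hΩ _ hm.1 hm.2.coeFn_toLp⟩
  obtain ⟨e, he, hnorm, h0, himm⟩ := exists_embedding_of_evaluation hΩ hevd hev
    ((lpConj (volume.restrict Ω)).comp (bergmanSubmodule Ω).subtypeₗᵢ) hrep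
  refine ⟨e, he, fun z hz => ?_, h0, himm⟩
  rw [hnorm z hz, bergmanDiag, (isBergmanKernel_bergmanKernel hΩ).unique
    (exists_isBergmanKernel_of_evaluation hΩ hev) hz hz]

end BergmanSpace

/-! ### The Bergman metric and `d log K_Ω` in terms of a Hilbert space valued map. -/

section MetricFormulas

variable {n : ℕ} {Ω : Set (Cn n)} {F : Type*} [NormedAddCommGroup F] [InnerProductSpace ℂ F]

/-- If the real derivative of `u` is the sum of a complex linear and a conjugate linear part, then
the Wirtinger derivative is given by the complex linear part. -/
theorem dz_eq_of_hasFDerivAt {u : Cn n → ℂ} {z : Cn n} {L : Cn n →L[ℝ] ℂ}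
    (hu : HasFDerivAt u L z) {A B : Cn n →ₗ[ℂ] ℂ} (hL : ∀ w, L w = A w + star (B w)) (α : Fin n) :
    dz α u z = A (Pi.single α 1) := by
  have hI : (Pi.single α Complex.I : Cn n) = Complex.I • Pi.single α 1 := by
    rw [← Pi.single_smul, smul_eq_mul, mul_one]
  rw [dz, hu.fderiv, hL, hL, hI, map_smul, map_smul]
  simp only [smul_eq_mul, star_mul', Complex.star_def, Complex.conj_I]
  linear_combination (-(1 / 2) * A (Pi.single α 1)
    + 1 / 2 * (starRingEnd ℂ) (B (Pi.single α 1))) * Complex.I_mul_I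

theorem dzbar_eq_of_hasFDerivAt {u : Cn n → ℂ} {z : Cn n} {L : Cn n →L[ℝ] ℂ}
    (hu : HasFDerivAt u L z) {A B : Cn n →ₗ[ℂ] ℂ} (hL : ∀ w, L w = A w + star (B w)) (α : Fin n) :
    dzbar α u z = star (B (Pi.single α 1)) := by
  have hI : (Pi.single α Complex.I : Cn n) = Complex.I • Pi.single α 1 := by
    rw [← Pi.single_smul, smul_eq_mul, mul_one]
  rw [dzbar, hu.fderiv, hL, hL, hI, map_smul, map_smul]
  simp only [smul_eq_mul, star_mul', Complex.star_def, Complex.conj_I]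
  linear_combination (1 / 2 * A (Pi.single α 1)
    - 1 / 2 * (starRingEnd ℂ) (B (Pi.single α 1))) * Complex.I_mul_I

/-- The derivative of `log ‖e‖²` in the holomorphic direction `v`. -/
def logNormDeriv (e : Cn n → F) (z : Cn n) : Cn n →ₗ[ℂ] ℂ where
  toFun v := inner ℂ (e z) (fderiv ℂ e z v) / (‖e z‖ : ℂ) ^ 2
  map_add' v w := by rw [map_add, inner_add_right, add_div]
  map_smul' c v := by
    rw [map_smul, inner_smul_right, mul_div_assoc]
    rfl

theorem logNormDeriv_apply (e : Cn n → F) (z v : Cn n) :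
    logNormDeriv e z v = inner ℂ (e z) (fderiv ℂ e z v) / (‖e z‖ : ℂ) ^ 2 := rfl

/-- The component of the derivative of `e` in the direction `v` that is orthogonal to `e`. -/
def orthDeriv (e : Cn n → F) (z : Cn n) : Cn n →ₗ[ℂ] F where
  toFun v := fderiv ℂ e z v - logNormDeriv e z v • e z
  map_add' v w := by
    rw [map_add, map_add, add_smul]
    abel
  map_smul' c v := by
    rw [map_smul, map_smul, smul_assoc, smul_sub]
    rfl

theorem orthDeriv_apply (e : Cn n → F) (z v : Cn n) :
    orthDeriv e z v = fderiv ℂ e z v - logNormDeriv e z v • e z := rfl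

theorem inner_orthDeriv {e : Cn n → F} {z : Cn n} (hz : e z ≠ 0) (v w : Cn n) :
    inner ℂ (orthDeriv e z v) (orthDeriv e z w) =
      inner ℂ (fderiv ℂ e z v) (fderiv ℂ e z w) -
        inner ℂ (fderiv ℂ e z v) (e z) * inner ℂ (e z) (fderiv ℂ e z w) / (‖e z‖ : ℂ) ^ 2 := by
  have h0 : (‖e z‖ : ℂ) ≠ 0 := by exact_mod_cast norm_ne_zero_iff.2 hz
  have h1 : inner ℂ (e z) (e z) = (‖e z‖ : ℂ) ^ 2 := inner_self_eq_norm_sq_to_K (𝕜 := ℂ) _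
  have h2 : (starRingEnd ℂ) (inner ℂ (e z) (fderiv ℂ e z v)) = inner ℂ (fderiv ℂ e z v) (e z) :=
    inner_conj_symm _ _
  simp only [orthDeriv_apply, logNormDeriv_apply, inner_sub_left, inner_sub_right,
    inner_smul_left, inner_smul_right, h1, map_div₀, h2, map_pow, Complex.conj_ofReal]
  field_simp
  ring

theorem hasFDerivAt_norm_sq {e : Cn n → F} {z : Cn n} (he : DifferentiableAt ℂ e z) :
    ∃ L : Cn n →L[ℝ] ℝ, HasFDerivAt (fun w => ‖e w‖ ^ 2) L z ∧
      ∀ w, (L w : ℂ) = inner ℂ (e z) (fderiv ℂ e z w) + inner ℂ (fderiv ℂ e z w) (e z) := by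
  have hd := he.hasFDerivAt.restrictScalars ℝ
  have h1 := Complex.reCLM.hasFDerivAt.comp z (hd.inner ℂ hd)
  have h2 : (fun w => ‖e w‖ ^ 2) = Complex.reCLM ∘ fun w => inner ℂ (e w) (e w) :=
    funext fun w => norm_sq_eq_re_inner (𝕜 := ℂ) (e w)
  refine ⟨_, h2 ▸ h1, fun w => ?_⟩
  have h : inner ℂ (fderiv ℂ e z w) (e z) = (starRingEnd ℂ) (inner ℂ (e z) (fderiv ℂ e z w)) :=
    (inner_conj_symm _ _).symm
  have h3 : ((Complex.reCLM.comp ((fderivInnerCLM ℂ (e z, e z)).comp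
      (((fderiv ℂ e z).restrictScalars ℝ).prod ((fderiv ℂ e z).restrictScalars ℝ)))) w) =
      (inner ℂ (e z) (fderiv ℂ e z w) + inner ℂ (fderiv ℂ e z w) (e z)).re := rfl
  rw [h3, h, Complex.add_conj, Complex.ofReal_re]

theorem hasFDerivAt_log_norm_sq {e : Cn n → F} {z : Cn n} (he : DifferentiableAt ℂ e z)
    (hz : e z ≠ 0) :
    ∃ L : Cn n →L[ℝ] ℂ, HasFDerivAt (fun w => ((Real.log (‖e w‖ ^ 2) : ℝ) : ℂ)) L z ∧
      ∀ w, L w = logNormDeriv e z w + star (logNormDeriv e z w) := by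
  obtain ⟨L, hL, hLw⟩ := hasFDerivAt_norm_sq he
  have h0 : ‖e z‖ ^ 2 ≠ 0 := by positivity
  refine ⟨_, Complex.ofRealCLM.hasFDerivAt.comp z (hL.log h0), fun w => ?_⟩
  have h2 : star (inner ℂ (e z) (fderiv ℂ e z w)) = inner ℂ (fderiv ℂ e z w) (e z) :=
    inner_conj_symm _ _
  simp only [logNormDeriv_apply, star_div₀, h2, star_pow, Complex.star_def, Complex.conj_ofReal]
  simp [hLw]
  ring

theorem logBergman_eventuallyEq {F : Type*} [NormedAddCommGroup F] {e : Cn n → F} (hΩ : IsOpen Ω)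
    (hK : ∀ z ∈ Ω, ‖e z‖ ^ 2 = bergmanDiag Ω z) {z : Cn n} (hz : z ∈ Ω) :
    logBergman Ω =ᶠ[𝓝 z] fun w => ((Real.log (‖e w‖ ^ 2) : ℝ) : ℂ) := by
  filter_upwards [hΩ.mem_nhds hz] with w hw
  rw [logBergman, hK w hw]

theorem hasFDerivAt_logBergman {e : Cn n → F} (hΩ : IsOpen Ω) (he : DifferentiableOn ℂ e Ω)
    (he0 : ∀ z ∈ Ω, e z ≠ 0) (hK : ∀ z ∈ Ω, ‖e z‖ ^ 2 = bergmanDiag Ω z) {z : Cn n} (hz : z ∈ Ω) :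
    ∃ L : Cn n →L[ℝ] ℂ, HasFDerivAt (logBergman Ω) L z ∧
      ∀ w, L w = logNormDeriv e z w + star (logNormDeriv e z w) := by
  obtain ⟨L, hL, hLw⟩ := hasFDerivAt_log_norm_sq (he.differentiableAt (hΩ.mem_nhds hz)) (he0 z hz)
  exact ⟨L, hL.congr_of_eventuallyEq (logBergman_eventuallyEq hΩ hK hz), hLw⟩

theorem dz_logBergman {e : Cn n → F} (hΩ : IsOpen Ω) (he : DifferentiableOn ℂ e Ω)
    (he0 : ∀ z ∈ Ω, e z ≠ 0) (hK : ∀ z ∈ Ω, ‖e z‖ ^ 2 = bergmanDiag Ω z) {z : Cn n} (hz : z ∈ Ω)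
    (α : Fin n) : dz α (logBergman Ω) z = logNormDeriv e z (Pi.single α 1) := by
  obtain ⟨L, hL, hLw⟩ := hasFDerivAt_logBergman hΩ he he0 hK hz
  exact dz_eq_of_hasFDerivAt hL hLw α

theorem dzbar_logBergman {e : Cn n → F} (hΩ : IsOpen Ω) (he : DifferentiableOn ℂ e Ω)
    (he0 : ∀ z ∈ Ω, e z ≠ 0) (hK : ∀ z ∈ Ω, ‖e z‖ ^ 2 = bergmanDiag Ω z) {z : Cn n} (hz : z ∈ Ω)
    (α : Fin n) : dzbar α (logBergman Ω) z = star (logNormDeriv e z (Pi.single α 1)) := by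
  obtain ⟨L, hL, hLw⟩ := hasFDerivAt_logBergman hΩ he he0 hK hz
  exact dzbar_eq_of_hasFDerivAt hL hLw α

/-- The Bergman metric is the pullback of the Fubini-Study metric. -/
theorem bergmanMetric_apply [CompleteSpace F] {e : Cn n → F} (hΩ : IsOpen Ω)
    (he : DifferentiableOn ℂ e Ω) (he0 : ∀ z ∈ Ω, e z ≠ 0)
    (hK : ∀ z ∈ Ω, ‖e z‖ ^ 2 = bergmanDiag Ω z) {z : Cn n} (hz : z ∈ Ω) (α β : Fin n) :
    bergmanMetric Ω z α β = inner ℂ (orthDeriv e z (Pi.single β 1))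
      (orthDeriv e z (Pi.single α 1)) / (‖e z‖ : ℂ) ^ 2 := by
  set b : Cn n := Pi.single β 1 with hb
  have h0 : (‖e z‖ : ℂ) ≠ 0 := by exact_mod_cast norm_ne_zero_iff.2 (he0 z hz)
  have h0' : ‖e z‖ ^ 2 ≠ 0 := by have := he0 z hz; positivity
  have hev : dzbar β (logBergman Ω) =ᶠ[𝓝 z]
      fun w => (‖e w‖ ^ 2)⁻¹ • inner ℂ (fderiv ℂ e w b) (e w) := by
    filter_upwards [hΩ.mem_nhds hz] with w hw
    have h2 : star (inner ℂ (e w) (fderiv ℂ e w b)) = inner ℂ (fderiv ℂ e w b) (e w) :=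
      inner_conj_symm _ _
    rw [dzbar_logBergman hΩ he he0 hK hw, ← hb, logNormDeriv_apply, star_div₀, h2, star_pow,
      Complex.star_def, Complex.conj_ofReal, Complex.real_smul]
    push_cast
    ring
  have hde := he.differentiableAt (hΩ.mem_nhds hz)
  have hdd : DifferentiableAt ℂ (fun w => fderiv ℂ e w b) z :=
    (differentiableOn_fderiv_apply hΩ he b).differentiableAt (hΩ.mem_nhds hz)
  obtain ⟨L, hL, hLw⟩ := hasFDerivAt_norm_sq hde
  have hinv : HasFDerivAt (fun w => (‖e w‖ ^ 2)⁻¹) (-((‖e z‖ ^ 2) ^ 2)⁻¹ • L) z :=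
    (hasDerivAt_inv h0').comp_hasFDerivAt z hL
  have hN := (hdd.hasFDerivAt.restrictScalars ℝ).inner ℂ (hde.hasFDerivAt.restrictScalars ℝ)
  have hu := (hinv.smul hN).congr_of_eventuallyEq hev
  -- `A` and the conjugate of `B` are the complex linear and conjugate linear parts of the
  -- derivative of `‖e‖⁻² ⟨de(b), e⟩`. The second derivative of `e` sits in the conjugate slot,
  -- hence only in `B`, and does not contribute to `∂/∂z^α`.
  let A : Cn n →ₗ[ℂ] ℂ :=
    ((‖e z‖ : ℂ) ^ 2)⁻¹ • ((innerSL ℂ (fderiv ℂ e z b)).comp (fderiv ℂ e z)).toLinearMap -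
      (inner ℂ (fderiv ℂ e z b) (e z) / ((‖e z‖ : ℂ) ^ 2) ^ 2) •
        ((innerSL ℂ (e z)).comp (fderiv ℂ e z)).toLinearMap
  let B : Cn n →ₗ[ℂ] ℂ :=
    ((‖e z‖ : ℂ) ^ 2)⁻¹ •
      ((innerSL ℂ (e z)).comp (fderiv ℂ (fun w => fderiv ℂ e w b) z)).toLinearMap -
      (inner ℂ (e z) (fderiv ℂ e z b) / ((‖e z‖ : ℂ) ^ 2) ^ 2) •
        ((innerSL ℂ (e z)).comp (fderiv ℂ e z)).toLinearMap
  have hAB : ∀ w, ((‖e z‖ ^ 2)⁻¹ • (fderivInnerCLM ℂ (fderiv ℂ e z b, e z)).comp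
      (((fderiv ℂ (fun w => fderiv ℂ e w b) z).restrictScalars ℝ).prod
        ((fderiv ℂ e z).restrictScalars ℝ)) +
      (-((‖e z‖ ^ 2) ^ 2)⁻¹ • L).smulRight (inner ℂ (fderiv ℂ e z b) (e z))) w =
        A w + star (B w) := by
    intro w
    have hAw : A w = ((‖e z‖ : ℂ) ^ 2)⁻¹ * inner ℂ (fderiv ℂ e z b) (fderiv ℂ e z w) -
      (inner ℂ (fderiv ℂ e z b) (e z) / ((‖e z‖ : ℂ) ^ 2) ^ 2) *
        inner ℂ (e z) (fderiv ℂ e z w) := rfl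
    have hBw : B w = ((‖e z‖ : ℂ) ^ 2)⁻¹ *
        inner ℂ (e z) (fderiv ℂ (fun w => fderiv ℂ e w b) z w) -
      (inner ℂ (e z) (fderiv ℂ e z b) / ((‖e z‖ : ℂ) ^ 2) ^ 2) *
        inner ℂ (e z) (fderiv ℂ e z w) := rfl
    have hc : ∀ x y : F, (starRingEnd ℂ) (inner ℂ x y) = inner ℂ y x := fun x y =>
      inner_conj_symm _ _
    rw [hAw, hBw]
    simp only [Complex.star_def, map_sub, map_mul, map_div₀, map_inv₀, map_pow,
      Complex.conj_ofReal, hc]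
    simp only [add_apply, smul_apply, ContinuousLinearMap.comp_apply,
      ContinuousLinearMap.prod_apply, fderivInnerCLM_apply, ContinuousLinearMap.smulRight_apply,
      ContinuousLinearMap.coe_restrictScalars', Complex.real_smul, smul_eq_mul,
      Complex.ofReal_mul, Complex.ofReal_neg, Complex.ofReal_inv, Complex.ofReal_pow, hLw]
    field_simp
    ring
  rw [bergmanMetric, Matrix.of_apply, dz_eq_of_hasFDerivAt hu hAB α,
    inner_orthDeriv (he0 z hz)]
  have hAw : A (Pi.single α 1) = ((‖e z‖ : ℂ) ^ 2)⁻¹ *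
      inner ℂ (fderiv ℂ e z b) (fderiv ℂ e z (Pi.single α 1)) -
      (inner ℂ (fderiv ℂ e z b) (e z) / ((‖e z‖ : ℂ) ^ 2) ^ 2) *
        inner ℂ (e z) (fderiv ℂ e z (Pi.single α 1)) := rfl
  rw [hAw]
  field_simp

/-- A linear map on `ℂⁿ` in terms of its values on the standard basis. -/
theorem map_eq_sum_single {M : Type*} [AddCommGroup M] [Module ℂ M] (T : Cn n →ₗ[ℂ] M) (v : Cn n) :
    T v = ∑ α, v α • T (Pi.single α 1) := by
  conv_lhs => rw [pi_eq_sum_univ' v]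
  simp [map_sum]

theorem logNormDeriv_eq_sum {e : Cn n → F} (hΩ : IsOpen Ω) (he : DifferentiableOn ℂ e Ω)
    (he0 : ∀ z ∈ Ω, e z ≠ 0) (hK : ∀ z ∈ Ω, ‖e z‖ ^ 2 = bergmanDiag Ω z) {z : Cn n} (hz : z ∈ Ω)
    (v : Cn n) : logNormDeriv e z v = ∑ α, v α • dz α (logBergman Ω) z := by
  rw [map_eq_sum_single]
  simp only [dz_logBergman hΩ he he0 hK hz]

theorem inner_orthDeriv_eq_sum [CompleteSpace F] {e : Cn n → F} (hΩ : IsOpen Ω)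
    (he : DifferentiableOn ℂ e Ω) (he0 : ∀ z ∈ Ω, e z ≠ 0)
    (hK : ∀ z ∈ Ω, ‖e z‖ ^ 2 = bergmanDiag Ω z) {z : Cn n} (hz : z ∈ Ω) (v w : Cn n) :
    inner ℂ (orthDeriv e z v) (orthDeriv e z w) / (‖e z‖ : ℂ) ^ 2 =
      ∑ β, ∑ α, star (v β) * w α * bergmanMetric Ω z α β := by
  rw [map_eq_sum_single (orthDeriv e z) v, map_eq_sum_single (orthDeriv e z) w, sum_inner,
    Finset.sum_div]
  refine Finset.sum_congr rfl fun β _ => ?_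
  rw [inner_sum, Finset.sum_div]
  refine Finset.sum_congr rfl fun α _ => ?_
  rw [bergmanMetric_apply hΩ he he0 hK hz, inner_smul_left, inner_smul_right, Complex.star_def]
  ring

/-- A bound on the length of `d log K` bounds the derivative of `log K` along every vector. -/
theorem norm_logNormDeriv_le [CompleteSpace F] {e : Cn n → F} (hΩ : IsOpen Ω)
    (he : DifferentiableOn ℂ e Ω) (he0 : ∀ z ∈ Ω, e z ≠ 0)
    (hK : ∀ z ∈ Ω, ‖e z‖ ^ 2 = bergmanDiag Ω z)
    (himm : ∀ z ∈ Ω, ∀ (v : Cn n) (c : ℂ), fderiv ℂ e z v = c • e z → v = 0)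
    {z : Cn n} (hz : z ∈ Ω) {C : ℝ} (hC : 0 ≤ C) (hlen : bergmanLengthSq Ω z ≤ C ^ 2) (v : Cn n) :
    ‖logNormDeriv e z v‖ ≤ C * (‖orthDeriv e z v‖ / ‖e z‖) := by
  have hN : 0 < ‖e z‖ := norm_pos_iff.2 (he0 z hz)
  have hNc : (‖e z‖ : ℂ) ≠ 0 := by exact_mod_cast hN.ne'
  set G := bergmanMetric Ω z with hG
  -- the metric in terms of the vectors with conjugate coordinates
  have hquad : ∀ x y : Cn n, ∑ α, star (x α) * (G.mulVec y) α =
      inner ℂ (orthDeriv e z (star y)) (orthDeriv e z (star x)) / (‖e z‖ : ℂ) ^ 2 := by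
    intro x y
    rw [inner_orthDeriv_eq_sum hΩ he he0 hK hz, Finset.sum_comm]
    refine Finset.sum_congr rfl fun α _ => ?_
    rw [Matrix.mulVec, dotProduct, Finset.mul_sum]
    refine Finset.sum_congr rfl fun β _ => ?_
    simp only [Pi.star_apply, star_star]
    ring
  have horth : ∀ v, orthDeriv e z v = 0 → v = 0 := fun v hv =>
    himm z hz v _ (sub_eq_zero.1 hv)
  -- A null vector of `G` would have zero Bergman length, against the immersion property.
  -- Invertibility is essential: `G⁻¹` would otherwise be the default value `0` and the length bound
  -- would carry no information.
  have hdet : IsUnit G.det := by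
    rw [isUnit_iff_ne_zero]
    intro h0
    obtain ⟨y, hy0, hy⟩ := Matrix.exists_mulVec_eq_zero_iff.2 h0
    have h := hquad y y
    rw [hy] at h
    simp only [Pi.zero_apply, mul_zero, Finset.sum_const_zero] at h
    have h' : inner ℂ (orthDeriv e z (star y)) (orthDeriv e z (star y)) = 0 := by
      have := (div_eq_zero_iff.1 h.symm).resolve_right (pow_ne_zero 2 hNc)
      exact this
    exact hy0 (star_eq_zero.1 (horth _ (inner_self_eq_zero.1 h')))
  set a : Cn n := fun α => dz α (logBergman Ω) z with ha
  -- `star y` is the gradient of `log K_Ω` for the metric: its squared length is `bergmanLengthSq Ω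
  -- z`, and pairing with it gives `logNormDeriv e z`. Cauchy-Schwarz then finishes.
  set y : Cn n := G⁻¹.mulVec a with hy
  have hGy : G.mulVec y = a := by
    rw [hy, Matrix.mulVec_mulVec, Matrix.mul_nonsing_inv _ hdet, Matrix.one_mulVec]
  have hlen' : bergmanLengthSq Ω z = ‖orthDeriv e z (star y)‖ ^ 2 / ‖e z‖ ^ 2 := by
    have h1 : ∑ α, ∑ β, dz α (logBergman Ω) z * dzbar β (logBergman Ω) z *
        (bergmanMetric Ω z)⁻¹ β α = ∑ β, star (a β) * y β := by
      rw [Finset.sum_comm]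
      refine Finset.sum_congr rfl fun β _ => ?_
      rw [hy, Matrix.mulVec, dotProduct, Finset.mul_sum]
      refine Finset.sum_congr rfl fun α _ => ?_
      rw [ha, dzbar_logBergman hΩ he he0 hK hz, ← dz_logBergman hΩ he he0 hK hz]
      ring
    have h2 : ∑ β, star (a β) * y β = star (∑ β, star (y β) * (G.mulVec y) β) := by
      rw [hGy, star_sum]
      refine Finset.sum_congr rfl fun β _ => ?_
      rw [star_mul', star_star, mul_comm]
    rw [bergmanLengthSq, h1, h2, hquad, inner_self_eq_norm_sq_to_K, Complex.star_def,
      Complex.conj_re]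
    have h3 : (‖orthDeriv e z (star y)‖ : ℂ) ^ 2 / (‖e z‖ : ℂ) ^ 2 =
        ((‖orthDeriv e z (star y)‖ ^ 2 / ‖e z‖ ^ 2 : ℝ) : ℂ) := by push_cast; rfl
    exact (congrArg Complex.re h3).trans (Complex.ofReal_re _)
  have hv : logNormDeriv e z v =
      inner ℂ (orthDeriv e z (star y)) (orthDeriv e z v) / (‖e z‖ : ℂ) ^ 2 := by
    have h := hquad (star v) y
    rw [hGy, star_star] at h
    rw [← h, logNormDeriv_eq_sum hΩ he he0 hK hz]
    simp [ha]
  have hY : ‖orthDeriv e z (star y)‖ ≤ C * ‖e z‖ := by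
    rw [hlen', div_le_iff₀ (by positivity), ← mul_pow] at hlen
    exact le_of_sq_le_sq hlen (by positivity)
  rw [hv, norm_div, norm_pow, Complex.norm_real, norm_norm, div_le_iff₀ (by positivity)]
  calc ‖inner ℂ (orthDeriv e z (star y)) (orthDeriv e z v)‖
      ≤ ‖orthDeriv e z (star y)‖ * ‖orthDeriv e z v‖ := norm_inner_le_norm _ _
    _ ≤ C * ‖e z‖ * ‖orthDeriv e z v‖ := by gcongr
    _ = C * (‖orthDeriv e z v‖ / ‖e z‖) * ‖e z‖ ^ 2 := by field_simp

end MetricFormulas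

/-! ### Jacobians of automorphisms, the transformation law, and the bound on `d log J_f`. -/

section Automorphisms

variable {n : ℕ} {Ω : Set (Cn n)}

theorem jacobian_eq_det (f : Cn n → Cn n) (z : Cn n) : jacobian f z = (fderiv ℂ f z).det := by
  rw [ContinuousLinearMap.det, ← LinearMap.det_toMatrix', jacobian]
  congr 1

/-- The real determinant of a complex linear map is the norm of its complex determinant; this feeds
the real change of variables formula. -/
theorem det_restrictScalars_fderiv (f : Cn n → Cn n) (z : Cn n) :
    ((fderiv ℂ f z).restrictScalars ℝ).det = ‖jacobian f z‖ ^ 2 := by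
  rw [jacobian_eq_det, ContinuousLinearMap.det, ContinuousLinearMap.det, ← Complex.normSq_eq_norm_sq,
    ← Algebra.norm_complex_apply, ← LinearMap.det_restrictScalars]
  rfl

theorem differentiableOn_jacobian (hΩ : IsOpen Ω) {f : Cn n → Cn n}
    (hf : DifferentiableOn ℂ f Ω) : DifferentiableOn ℂ (jacobian f) Ω := by
  have h : ∀ α β : Fin n, DifferentiableOn ℂ (fun z => fderiv ℂ f z (Pi.single β 1) α) Ω :=
    fun α β => differentiableOn_pi.1 (differentiableOn_fderiv_apply hΩ hf _) α
  have heq : jacobian f = fun z => ∑ σ : Equiv.Perm (Fin n), (Equiv.Perm.sign σ : ℂ) *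
      ∏ i, fderiv ℂ f z (Pi.single i 1) (σ i) := by
    ext z
    rw [jacobian, Matrix.det_apply']
    rfl
  rw [heq]
  refine DifferentiableOn.fun_sum fun σ _ => DifferentiableOn.const_mul ?_ _
  intro z hz
  exact (HasFDerivWithinAt.finsetProd
    fun i _ => (h (σ i) i z hz).hasFDerivWithinAt).differentiableWithinAt

theorem jacobian_mul_jacobian (hΩ : IsOpen Ω) {f g : Cn n → Cn n} (hf : DifferentiableOn ℂ f Ω)
    (hg : DifferentiableOn ℂ g Ω) (hfm : MapsTo f Ω Ω) (hgf : LeftInvOn g f Ω) {z : Cn n}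
    (hz : z ∈ Ω) : jacobian g (f z) * jacobian f z = 1 := by
  have h1 : HasFDerivAt (g ∘ f) ((fderiv ℂ g (f z)).comp (fderiv ℂ f z)) z :=
    (hg.differentiableAt (hΩ.mem_nhds (hfm hz))).hasFDerivAt.comp z
      (hf.differentiableAt (hΩ.mem_nhds hz)).hasFDerivAt
  have h2 : HasFDerivAt (g ∘ f) (ContinuousLinearMap.id ℂ (Cn n)) z := by
    refine (hasFDerivAt_id z).congr_of_eventuallyEq ?_
    filter_upwards [hΩ.mem_nhds hz] with w hw using hgf hw
  have h3 := h1.unique h2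
  rw [jacobian_eq_det, jacobian_eq_det, ContinuousLinearMap.det, ContinuousLinearMap.det,
    ← LinearMap.det_comp]
  have h4 : (fderiv ℂ g (f z)).toLinearMap ∘ₗ (fderiv ℂ f z).toLinearMap = LinearMap.id :=
    congrArg ContinuousLinearMap.toLinearMap h3
  rw [h4, LinearMap.det_id]

theorem jacobian_ne_zero (hΩ : IsOpen Ω) {f : Cn n → Cn n} (hf : IsAutomorphism Ω f) {z : Cn n}
    (hz : z ∈ Ω) : jacobian f z ≠ 0 := by
  obtain ⟨hfd, hfm, g, hgd, hgm, hgf⟩ := hf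
  intro h0
  have := jacobian_mul_jacobian hΩ hfd hgd hfm hgf.1 hz
  rw [h0, mul_zero] at this
  exact zero_ne_one this

theorem hasFDerivWithinAt_real (hΩ : IsOpen Ω) {f : Cn n → Cn n} (hf : DifferentiableOn ℂ f Ω) :
    ∀ z ∈ Ω, HasFDerivWithinAt f ((fderiv ℂ f z).restrictScalars ℝ) Ω z := fun _ hz =>
  ((hf.differentiableAt (hΩ.mem_nhds hz)).hasFDerivAt.restrictScalars ℝ).hasFDerivWithinAt

/-- The pullback of an `A²` function, as a holomorphic half-density, is again in `A²`. -/
theorem comp_mul_jacobian_mem_bergmanSpace (hΩ : IsOpen Ω) {f : Cn n → Cn n}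
    (hf : DifferentiableOn ℂ f Ω) (hfb : BijOn f Ω Ω) {u : Cn n → ℂ} (hu : u ∈ bergmanSpace Ω) :
    (fun z => u (f z) * jacobian f z) ∈ bergmanSpace Ω := by
  have hd : DifferentiableOn ℂ (fun z => u (f z) * jacobian f z) Ω :=
    (hu.1.comp hf hfb.mapsTo).mul (differentiableOn_jacobian hΩ hf)
  refine ⟨hd, ?_⟩
  rw [memLp_two_iff_integrable_sq_norm (hd.continuousOn.aestronglyMeasurable hΩ.measurableSet)]
  have h1 : IntegrableOn (fun z => ‖u z‖ ^ 2) Ω :=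
    (memLp_two_iff_integrable_sq_norm hu.2.1).1 hu.2
  have h2 := (integrableOn_image_iff_integrableOn_abs_det_fderiv_smul volume hΩ.measurableSet
    (hasFDerivWithinAt_real hΩ hf) hfb.injOn (fun z => ‖u z‖ ^ 2)).1 (by rwa [hfb.image_eq])
  refine h2.congr (Eventually.of_forall fun z => ?_)
  simp only [det_restrictScalars_fderiv, abs_pow, abs_norm, smul_eq_mul, norm_mul]
  ring

theorem setIntegral_comp_mul_normSq (hΩ : IsOpen Ω) {f : Cn n → Cn n}
    (hf : DifferentiableOn ℂ f Ω) (hfb : BijOn f Ω Ω) (v : Cn n → ℂ) :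
    ∫ z in Ω, v z = ∫ z in Ω, jacobian f z * star (jacobian f z) * v (f z) := by
  have h := integral_image_eq_integral_abs_det_fderiv_smul volume hΩ.measurableSet
    (hasFDerivWithinAt_real hΩ hf) hfb.injOn v
  rw [hfb.image_eq] at h
  rw [h]
  refine integral_congr_ae (Eventually.of_forall fun z => ?_)
  simp only [det_restrictScalars_fderiv, abs_pow, abs_norm, Complex.real_smul]
  rw [Complex.star_def, Complex.mul_conj, Complex.normSq_eq_norm_sq]

/-- The transformation law of the Bergman kernel function. -/
theorem bergmanDiag_eq_mul (hΩ : IsOpen Ω) {f : Cn n → Cn n} (hf : IsAutomorphism Ω f) {z : Cn n}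
    (hz : z ∈ Ω) : bergmanDiag Ω z = bergmanDiag Ω (f z) * ‖jacobian f z‖ ^ 2 := by
  obtain ⟨hfd, hfm, g, hgd, hgm, hgf⟩ := hf
  have hfb : BijOn f Ω Ω := hgf.bijOn hfm hgm
  have hgb : BijOn g Ω Ω := hgf.symm.bijOn hgm hfm
  have hk := isBergmanKernel_bergmanKernel hΩ
  -- The pulled-back kernel also reproduces: apply the kernel at `f w` to `(u ∘ g) J_g` and change
  -- variables by `f`. Uniqueness then gives the law.
  have hk' : IsBergmanKernel Ω fun z w =>
      bergmanKernel Ω (f z) (f w) * jacobian f z * star (jacobian f w) := by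
    intro w hw
    have hmem := comp_mul_jacobian_mem_bergmanSpace hΩ hfd hfb (hk (f w) (hfm hw)).1
    refine ⟨⟨hmem.1.mul_const _, hmem.2.mul_const _⟩, fun u hu => ?_⟩
    have hu' := comp_mul_jacobian_mem_bergmanSpace hΩ hgd hgb hu
    have h1 := (hk (f w) (hfm hw)).2 _ hu'
    rw [setIntegral_comp_mul_normSq hΩ hfd hfb] at h1
    have h2 : u w = u (g (f w)) * jacobian g (f w) * jacobian f w := by
      rw [mul_assoc, jacobian_mul_jacobian hΩ hfd hgd hfm hgf.1 hw, mul_one, hgf.1 hw]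
    rw [h2, h1, ← integral_mul_const]
    refine setIntegral_congr_fun hΩ.measurableSet fun x hx => ?_
    have h3 := jacobian_mul_jacobian hΩ hfd hgd hfm hgf.1 hx
    simp only [star_mul', star_star, hgf.1 hx]
    linear_combination (star (jacobian f x) * u x * star (bergmanKernel Ω (f x) (f w)) *
      jacobian f w) * h3
  rw [bergmanDiag, bergmanDiag, hk.unique hk' hz hz]
  have h4 : bergmanKernel Ω (f z) (f z) * jacobian f z * star (jacobian f z) =
      bergmanKernel Ω (f z) (f z) * ((‖jacobian f z‖ ^ 2 : ℝ) : ℂ) := by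
    rw [mul_assoc, Complex.star_def, Complex.mul_conj, Complex.normSq_eq_norm_sq]
  rw [h4, Complex.re_mul_ofReal]

/-- The product rule `∂ log ‖J · (e ∘ f)‖² = d log J + f^*(∂ log ‖e‖²)` at a point, with `J'` in the
role of `dJ(v)` and `v'` of `df(v)`. -/
theorem logNormDeriv_smul_comp {F : Type*} [NormedAddCommGroup F] [InnerProductSpace ℂ F]
    {e e' : Cn n → F} {z p v v' : Cn n} {J J' : ℂ} (hJ : J ≠ 0) (hp : e p ≠ 0)
    (hval : e' z = J • e p) (hder : fderiv ℂ e' z v = J' • e p + J • fderiv ℂ e p v') :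
    logNormDeriv e' z v = J' / J + logNormDeriv e p v' := by
  have h0 : (‖e p‖ : ℂ) ≠ 0 := by exact_mod_cast norm_ne_zero_iff.2 hp
  have h1 : inner ℂ (e p) (e p) = (‖e p‖ : ℂ) ^ 2 := inner_self_eq_norm_sq_to_K (𝕜 := ℂ) _
  have h2 : (‖J‖ : ℂ) ^ 2 = (starRingEnd ℂ) J * J := (Complex.conj_mul' J).symm
  have h3 : (starRingEnd ℂ) J ≠ 0 := (map_ne_zero _).2 hJ
  rw [logNormDeriv_apply, logNormDeriv_apply, hval, hder, norm_smul]
  simp only [inner_add_right, inner_smul_left, inner_smul_right, h1, Complex.ofReal_mul, mul_pow, h2]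
  field_simp

theorem norm_orthDeriv_le {F : Type*} [NormedAddCommGroup F] [InnerProductSpace ℂ F]
    {e : Cn n → F} {z : Cn n} (hz : e z ≠ 0) (v : Cn n) :
    ‖orthDeriv e z v‖ ≤ 2 * ‖fderiv ℂ e z v‖ := by
  have h0 : 0 < ‖e z‖ := norm_pos_iff.2 hz
  have h1 : ‖logNormDeriv e z v • e z‖ ≤ ‖fderiv ℂ e z v‖ := by
    rw [norm_smul, logNormDeriv_apply, norm_div, norm_pow, Complex.norm_real, norm_norm,
      div_mul_eq_mul_div, div_le_iff₀ (by positivity)]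
    nlinarith [norm_inner_le_norm (𝕜 := ℂ) (e z) (fderiv ℂ e z v)]
  rw [orthDeriv_apply]
  linarith [norm_sub_le (fderiv ℂ e z v) (logNormDeriv e z v • e z)]

/-- If `d log K` has bounded length, so has `d log J_f`, uniformly in the automorphism `f`. -/
theorem exists_norm_fderiv_jacobian_le (hΩ : IsOpen Ω) (hb : Bornology.IsBounded Ω) {C : ℝ}
    (hC : 0 ≤ C) (hlen : ∀ z ∈ Ω, bergmanLengthSq Ω z ≤ C ^ 2) :
    ∀ z₀ ∈ Ω, ∃ V ∈ 𝓝 z₀, ∃ M : ℝ, ∀ f, IsAutomorphism Ω f → ∀ z ∈ V,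
      ‖fderiv ℂ (jacobian f) z‖ ≤ M * ‖jacobian f z‖ := by
  obtain ⟨e, he, hK, he0, himm⟩ := exists_bergman_embedding hΩ hb
  have hpt : ∀ f, IsAutomorphism Ω f → ∀ z ∈ Ω, ∀ v,
      ‖fderiv ℂ (jacobian f) z v‖ ≤ 2 * C * (‖orthDeriv e z v‖ / ‖e z‖) * ‖jacobian f z‖ := by
    intro f hf z hz v
    have hfz := hf.2.1 hz
    have hfd := hf.1.differentiableAt (hΩ.mem_nhds hz)
    have hJd := (differentiableOn_jacobian hΩ hf.1).differentiableAt (hΩ.mem_nhds hz)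
    have hJ0 : ∀ w ∈ Ω, jacobian f w ≠ 0 := fun w hw => jacobian_ne_zero hΩ hf hw
    -- A second holomorphic map inducing `K_Ω`. Logarithmic derivative and orthogonal length depend
    -- only on `K_Ω`, so they agree for `e` and `e'`.
    let e' : Cn n → Lp ℂ 2 ((volume : Measure (Cn n)).restrict Ω) :=
      fun w => jacobian f w • e (f w)
    have hcomp : DifferentiableOn ℂ (fun w => e (f w)) Ω := he.comp hf.1 hf.2.1
    have he' : DifferentiableOn ℂ e' Ω := (differentiableOn_jacobian hΩ hf.1).smul hcomp
    have he'0 : ∀ w ∈ Ω, e' w ≠ 0 := fun w hw =>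
      smul_ne_zero (hJ0 w hw) (he0 _ (hf.2.1 hw))
    have hK' : ∀ w ∈ Ω, ‖e' w‖ ^ 2 = bergmanDiag Ω w := by
      intro w hw
      rw [norm_smul, mul_pow, hK _ (hf.2.1 hw), bergmanDiag_eq_mul hΩ hf hw, mul_comm]
    have hJ := hJ0 z hz
    have hp := he0 _ hfz
    have hder : fderiv ℂ e' z v = fderiv ℂ (jacobian f) z v • e (f z) +
        jacobian f z • fderiv ℂ e (f z) (fderiv ℂ f z v) := by
      have h1 : HasFDerivAt (fun w => e (f w)) ((fderiv ℂ e (f z)).comp (fderiv ℂ f z)) z :=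
        (he.differentiableAt (hΩ.mem_nhds hfz)).hasFDerivAt.comp z hfd.hasFDerivAt
      have h2 : HasFDerivAt e' _ z := hJd.hasFDerivAt.smul h1
      rw [h2.fderiv]
      simp [add_comm]
    have hlog := logNormDeriv_smul_comp (e := e) (p := f z) (v' := fderiv ℂ f z v) hJ hp
      (e' := e') rfl hder
    have horth : orthDeriv e' z v = jacobian f z • orthDeriv e (f z) (fderiv ℂ f z v) := by
      have h3 : e' z = jacobian f z • e (f z) := rfl
      rw [orthDeriv_apply, orthDeriv_apply, hlog, hder, h3]
      match_scalars <;> field_simp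
      ring
    have hnorm : ‖e' z‖ = ‖e z‖ := by
      rw [← sq_eq_sq₀ (norm_nonneg _) (norm_nonneg _), hK' z hz, hK z hz]
    have hloge : logNormDeriv e' z v = logNormDeriv e z v := by
      rw [logNormDeriv_eq_sum hΩ he' he'0 hK' hz, logNormDeriv_eq_sum hΩ he he0 hK hz]
    have horthe : ‖orthDeriv e' z v‖ = ‖orthDeriv e z v‖ := by
      have h4 := (inner_orthDeriv_eq_sum hΩ he' he'0 hK' hz v v).trans
        (inner_orthDeriv_eq_sum hΩ he he0 hK hz v v).symm
      have h5 : ((‖e z‖ : ℂ)) ^ 2 ≠ 0 := by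
        exact_mod_cast pow_ne_zero 2 (norm_ne_zero_iff.2 (he0 z hz))
      rw [hnorm, div_left_inj' h5, inner_self_eq_norm_sq_to_K, inner_self_eq_norm_sq_to_K] at h4
      rw [← sq_eq_sq₀ (norm_nonneg _) (norm_nonneg _)]
      exact_mod_cast h4
    -- Invariance of the Bergman metric under `f`.
    have hratio : ‖orthDeriv e (f z) (fderiv ℂ f z v)‖ / ‖e (f z)‖ =
        ‖orthDeriv e z v‖ / ‖e z‖ := by
      have h6 : ‖e' z‖ = ‖jacobian f z‖ * ‖e (f z)‖ := norm_smul _ _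
      rw [← horthe, ← hnorm, horth, h6, norm_smul,
        mul_div_mul_left _ _ (norm_ne_zero_iff.2 hJ)]
    have hb1 := norm_logNormDeriv_le hΩ he he0 hK himm hz hC (hlen z hz) v
    have hb2 := norm_logNormDeriv_le hΩ he he0 hK himm hfz hC (hlen _ hfz) (fderiv ℂ f z v)
    rw [hratio] at hb2
    have hquot : fderiv ℂ (jacobian f) z v / jacobian f z =
        logNormDeriv e z v - logNormDeriv e (f z) (fderiv ℂ f z v) := by
      rw [← hloge, hlog]
      ring
    rw [← div_le_iff₀ (norm_pos_iff.2 hJ), ← norm_div, hquot]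
    refine (norm_sub_le _ _).trans ?_
    linarith
  intro z₀ hz₀
  obtain ⟨R, hR, hB⟩ := exists_closedBall_two_mul_subset hΩ hz₀
  obtain ⟨m, hm⟩ := (isCompact_closedBall z₀ (2 * R)).exists_bound_of_continuousOn
    (he.continuousOn.mono hB)
  have hpos : 0 < ‖e z₀‖ := norm_pos_iff.2 (he0 z₀ hz₀)
  have hlow : ∀ᶠ z in 𝓝 z₀, ‖e z₀‖ / 2 < ‖e z‖ :=
    (he.continuousOn.continuousAt (hΩ.mem_nhds hz₀)).norm.eventually
      (lt_mem_nhds (half_lt_self hpos))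
  -- On this neighbourhood `‖e‖` is bounded below and Cauchy's estimate gives `‖de‖ ≤ 2 * m / R`, so
  -- the Bergman length is dominated by the Euclidean one, independently of `f`.
  refine ⟨Metric.ball z₀ R ∩ {z | ‖e z₀‖ / 2 < ‖e z‖},
    inter_mem (Metric.ball_mem_nhds z₀ hR) hlow,
    2 * C * (2 * (2 * m / R) / (‖e z₀‖ / 2)), fun f hf z hz => ?_⟩
  have hsub : Metric.ball z R ⊆ Metric.closedBall z₀ (2 * R) := by
    intro w hw
    have hz1 := hz.1
    rw [Metric.mem_ball] at hw hz1
    rw [Metric.mem_closedBall]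
    linarith [dist_triangle w z z₀]
  have hzΩ : z ∈ Ω := hB (hsub (Metric.mem_ball_self hR))
  have hde := norm_fderiv_le_of_norm_le hR (he.mono (hsub.trans hB)) fun w hw => hm w (hsub hw)
  have hm0 : 0 ≤ 2 * m / R := (norm_nonneg _).trans hde
  refine ContinuousLinearMap.opNorm_le_bound _ (by positivity) fun v => ?_
  refine (hpt f hf z hzΩ v).trans ?_
  have h1 : ‖orthDeriv e z v‖ ≤ 2 * (2 * m / R) * ‖v‖ := by
    have h2 := norm_orthDeriv_le (he0 z hzΩ) v
    have h3 : ‖fderiv ℂ e z v‖ ≤ 2 * m / R * ‖v‖ :=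
      ((fderiv ℂ e z).le_opNorm v).trans (by gcongr)
    linarith
  calc 2 * C * (‖orthDeriv e z v‖ / ‖e z‖) * ‖jacobian f z‖
      ≤ 2 * C * (2 * (2 * m / R) * ‖v‖ / (‖e z₀‖ / 2)) * ‖jacobian f z‖ := by
        gcongr
        exact hz.2.le
    _ = _ := by ring

end Automorphisms

/-! ### Harnack inequality from a bounded logarithmic derivative. -/

section Harnack

open Metric

/-- A function with bounded logarithmic derivative satisfies a Harnack inequality. -/
theorem norm_le_exp_mul_norm {E : Type*} [NormedAddCommGroup E] [NormedSpace ℂ E] {J : E → ℂ}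
    {c : E} {r M : ℝ} (hJ : ∀ z ∈ ball c r, DifferentiableAt ℂ J z)
    (hM : ∀ z ∈ ball c r, ‖fderiv ℂ J z‖ ≤ M * ‖J z‖) (hM0 : 0 ≤ M) {z w : E}
    (hz : z ∈ ball c r) (hw : w ∈ ball c r) : ‖J z‖ ≤ Real.exp (M * (2 * r)) * ‖J w‖ := by
  have hseg : ∀ t ∈ Icc (0 : ℝ) 1, w + (t : ℂ) • (z - w) ∈ ball c r := by
    intro t ht
    have h := (convex_ball c r).add_smul_sub_mem hw hz ht
    rwa [← Complex.coe_smul] at h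
  have hderiv : ∀ t ∈ Icc (0 : ℝ) 1, HasDerivAt (fun t : ℝ => J (w + (t : ℂ) • (z - w)))
      (fderiv ℂ J (w + (t : ℂ) • (z - w)) (z - w)) t := by
    intro t ht
    have h1 : HasDerivAt (fun t : ℝ => w + (t : ℂ) • (z - w)) (z - w) t := by
      simpa using ((Complex.ofRealCLM.hasDerivAt (x := t)).smul_const (z - w)).const_add w
    exact ((hJ _ (hseg t ht)).hasFDerivAt.restrictScalars ℝ).comp_hasDerivAt t h1
  have hdist : ‖z - w‖ ≤ 2 * r := by
    rw [← dist_eq_norm]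
    rw [mem_ball] at hz hw
    linarith [dist_triangle_right z w c]
  -- Grönwall along the segment from `w` to `z`, whose length is at most `2 * r`. No division by `J`
  -- is needed, so zeros of `J` do not matter.
  have h := norm_le_gronwallBound_of_norm_deriv_right_le (K := M * (2 * r)) (ε := 0)
    (fun t ht => (hderiv t ht).continuousAt.continuousWithinAt)
    (fun t ht => (hderiv t (Ico_subset_Icc_self ht)).hasDerivWithinAt) le_rfl
    (fun t ht => by
      have h1 := hM _ (hseg t (Ico_subset_Icc_self ht))
      have h2 := (fderiv ℂ J (w + (t : ℂ) • (z - w))).le_opNorm (z - w)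
      calc _ ≤ ‖fderiv ℂ J (w + (t : ℂ) • (z - w))‖ * ‖z - w‖ := h2
        _ ≤ M * ‖J (w + (t : ℂ) • (z - w))‖ * (2 * r) := by gcongr
        _ = _ := by ring) 1 (right_mem_Icc.2 zero_le_one)
  rw [gronwallBound_ε0] at h
  simpa [mul_comm] using h

end Harnack

/-! ### Uniform comparison of Jacobians, from local to global. -/

section NormalFamily

variable {n : ℕ} {Ω : Set (Cn n)}

/-- Jacobians of automorphisms are comparable near every point, uniformly in the automorphism. -/
theorem exists_norm_jacobian_le_nhds (hΩ : IsOpen Ω) (hb : Bornology.IsBounded Ω) {C : ℝ}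
    (hC : 0 ≤ C) (hlen : ∀ z ∈ Ω, bergmanLengthSq Ω z ≤ C ^ 2) {z₀ : Cn n} (hz₀ : z₀ ∈ Ω) :
    ∃ V ∈ 𝓝 z₀, ∃ A : ℝ, 0 < A ∧ ∀ f, IsAutomorphism Ω f → ∀ z ∈ V, ∀ w ∈ V,
      ‖jacobian f z‖ ≤ A * ‖jacobian f w‖ := by
  obtain ⟨V, hV, M, hM⟩ := exists_norm_fderiv_jacobian_le hΩ hb hC hlen z₀ hz₀
  obtain ⟨r, hr, hrV⟩ := Metric.mem_nhds_iff.1 (inter_mem hV (hΩ.mem_nhds hz₀))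
  -- The sign of `M` is not known, while the Harnack inequality asks for a nonnegative constant.
  refine ⟨Metric.ball z₀ r, Metric.ball_mem_nhds z₀ hr, Real.exp (max M 0 * (2 * r)),
    Real.exp_pos _, fun f hf z hz w hw => ?_⟩
  refine norm_le_exp_mul_norm
    (fun x hx => (differentiableOn_jacobian hΩ hf.1).differentiableAt (hΩ.mem_nhds (hrV hx).2))
    (fun x hx => (hM f hf x (hrV hx).1).trans ?_) (le_max_right _ _) hz hw
  gcongr
  exact le_max_left _ _

/-- Comparability with a constant independent of `f` is transitive and holds in both directions
between nearby points, so connectedness spreads it to all pairs. -/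
theorem exists_norm_jacobian_le (hΩ : IsOpen Ω) (hconn : IsConnected Ω)
    (hb : Bornology.IsBounded Ω) {C : ℝ} (hC : 0 ≤ C)
    (hlen : ∀ z ∈ Ω, bergmanLengthSq Ω z ≤ C ^ 2) {z w : Cn n} (hz : z ∈ Ω) (hw : w ∈ Ω) :
    ∃ A : ℝ, 0 < A ∧ ∀ f, IsAutomorphism Ω f → ‖jacobian f z‖ ≤ A * ‖jacobian f w‖ := by
  refine hconn.isPreconnected.induction₂' (fun z w => ∃ A : ℝ, 0 < A ∧
    ∀ f, IsAutomorphism Ω f → ‖jacobian f z‖ ≤ A * ‖jacobian f w‖) ?_ ?_ hz hw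
  · intro x hx
    obtain ⟨V, hV, A, hA, h⟩ := exists_norm_jacobian_le_nhds hΩ hb hC hlen hx
    filter_upwards [mem_nhdsWithin_of_mem_nhds hV] with y hy
    exact ⟨⟨A, hA, fun f hf => h f hf x (mem_of_mem_nhds hV) y hy⟩,
      ⟨A, hA, fun f hf => h f hf y hy x (mem_of_mem_nhds hV)⟩⟩
  · rintro x y z - - - ⟨A, hA, h⟩ ⟨B, hB, h'⟩
    refine ⟨A * B, by positivity, fun f hf => (h f hf).trans ?_⟩
    rw [mul_assoc]
    exact mul_le_mul_of_nonneg_left (h' f hf) hA.le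

theorem exists_norm_jacobian_le_of_isCompact (hΩ : IsOpen Ω) (hconn : IsConnected Ω)
    (hb : Bornology.IsBounded Ω) {C : ℝ} (hC : 0 ≤ C)
    (hlen : ∀ z ∈ Ω, bergmanLengthSq Ω z ≤ C ^ 2) {K : Set (Cn n)} (hK : IsCompact K)
    (hKΩ : K ⊆ Ω) {z₀ : Cn n} (hz₀ : z₀ ∈ Ω) :
    ∃ V ∈ 𝓝 z₀, ∃ A : ℝ, 0 < A ∧ ∀ f, IsAutomorphism Ω f → ∀ p ∈ K, ∀ z ∈ V,
      ‖jacobian f z‖ ≤ A * ‖jacobian f p‖ ∧ ‖jacobian f p‖ ≤ A * ‖jacobian f z‖ := by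
  obtain ⟨V, hV, A, hA, h⟩ := exists_norm_jacobian_le_nhds hΩ hb hC hlen hz₀
  have hKb : ∃ B : ℝ, 0 < B ∧ ∀ f, IsAutomorphism Ω f → ∀ p ∈ K,
      ‖jacobian f z₀‖ ≤ B * ‖jacobian f p‖ ∧ ‖jacobian f p‖ ≤ B * ‖jacobian f z₀‖ := by
    -- Compact induction replaces a finite subcover: near each `x ∈ K`, points are compared with `x`
    -- by the local estimate and `x` with `z₀` by the global one.
    refine hK.induction_on (p := fun S => ∃ B : ℝ, 0 < B ∧ ∀ f, IsAutomorphism Ω f → ∀ p ∈ S,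
      ‖jacobian f z₀‖ ≤ B * ‖jacobian f p‖ ∧ ‖jacobian f p‖ ≤ B * ‖jacobian f z₀‖)
      ⟨1, one_pos, by simp⟩ ?_ ?_ ?_
    · rintro S T hST ⟨B, hB, h⟩
      exact ⟨B, hB, fun f hf p hp => h f hf p (hST hp)⟩
    · rintro S T ⟨B, hB, h⟩ ⟨B', hB', h'⟩
      refine ⟨max B B', lt_max_of_lt_left hB, fun f hf p hp => ?_⟩
      have h1 := le_max_left B B'
      have h2 := le_max_right B B'
      rcases hp with hp | hp
      · exact ⟨(h f hf p hp).1.trans (by gcongr), (h f hf p hp).2.trans (by gcongr)⟩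
      · exact ⟨(h' f hf p hp).1.trans (by gcongr), (h' f hf p hp).2.trans (by gcongr)⟩
    · intro x hx
      obtain ⟨W, hW, D, hD, hWD⟩ := exists_norm_jacobian_le_nhds hΩ hb hC hlen (hKΩ hx)
      obtain ⟨B, hB, hB1⟩ := exists_norm_jacobian_le hΩ hconn hb hC hlen hz₀ (hKΩ hx)
      obtain ⟨B', hB', hB2⟩ := exists_norm_jacobian_le hΩ hconn hb hC hlen (hKΩ hx) hz₀
      refine ⟨W, mem_nhdsWithin_of_mem_nhds hW, max (B * D) (D * B'),
        lt_max_of_lt_left (by positivity), fun f hf p hp => ?_⟩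
      have hxW := mem_of_mem_nhds hW
      constructor
      · calc ‖jacobian f z₀‖ ≤ B * (D * ‖jacobian f p‖) :=
              (hB1 f hf).trans (mul_le_mul_of_nonneg_left (hWD f hf x hxW p hp) hB.le)
          _ = B * D * ‖jacobian f p‖ := by ring
          _ ≤ _ := mul_le_mul_of_nonneg_right (le_max_left _ _) (norm_nonneg _)
      · calc ‖jacobian f p‖ ≤ D * (B' * ‖jacobian f z₀‖) :=
              (hWD f hf p hp x hxW).trans (mul_le_mul_of_nonneg_left (hB2 f hf) hD.le)
          _ = D * B' * ‖jacobian f z₀‖ := by ring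
          _ ≤ _ := mul_le_mul_of_nonneg_right (le_max_right _ _) (norm_nonneg _)
  obtain ⟨B, hB, hBK⟩ := hKb
  refine ⟨V, hV, A * B, by positivity, fun f hf p hp z hz => ⟨?_, ?_⟩⟩
  · rw [mul_assoc]
    exact (h f hf z hz z₀ (mem_of_mem_nhds hV)).trans
      (mul_le_mul_of_nonneg_left (hBK f hf p hp).1 hA.le)
  · rw [mul_comm A, mul_assoc]
    exact (hBK f hf p hp).2.trans
      (mul_le_mul_of_nonneg_left (h f hf z₀ (mem_of_mem_nhds hV) z hz) hB.le)

end NormalFamily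

end BergmanScaling

end

open BergmanScaling in
theorem theorem2p4 (n : ℕ) (Ω : Set (Cn n)) (hopen : IsOpen Ω) (hconn : IsConnected Ω)
    (hbdd : Bornology.IsBounded Ω)
    (hlength : ∃ C : ℝ, 0 < C ∧ ∀ z ∈ Ω, bergmanLengthSq Ω z < C ^ 2)
    (K : Set (Cn n)) (hK : IsCompact K) (hKΩ : K ⊆ Ω) :
    IsNormalFamily Ω (jacobianFamily Ω K) ∧
      ∀ (u : ℕ → Cn n → ℂ) (h : Cn n → ℂ), (∀ j, u j ∈ jacobianFamily Ω K) →
        TendstoLocallyUniformlyOn u h atTop Ω →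
          DifferentiableOn ℂ h Ω ∧ ∀ z ∈ Ω, h z ≠ 0 := by
  obtain ⟨C, hC, hlen⟩ := hlength
  have hd : ∀ h ∈ jacobianFamily Ω K, DifferentiableOn ℂ h Ω := by
    rintro _ ⟨f, hf, p, -, rfl⟩
    simpa only [div_eq_mul_inv] using
      (differentiableOn_jacobian hopen hf.1).mul_const (jacobian f p)⁻¹
  -- Dividing the two-sided comparison by `‖jacobian f p‖` makes it uniform over the family; the
  -- upper half serves Montel, the lower half nonvanishing.
  have hbounds : ∀ z₀ ∈ Ω, ∃ V ∈ 𝓝 z₀, ∃ A : ℝ, 0 < A ∧ ∀ h ∈ jacobianFamily Ω K, ∀ z ∈ V,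
      ‖h z‖ ≤ A ∧ A⁻¹ ≤ ‖h z‖ := by
    intro z₀ hz₀
    obtain ⟨V, hV, A, hA, hVA⟩ := exists_norm_jacobian_le_of_isCompact hopen hconn hbdd hC.le
      (fun z hz => (hlen z hz).le) hK hKΩ hz₀
    refine ⟨V, hV, A, hA, ?_⟩
    rintro _ ⟨f, hf, p, hp, rfl⟩ z hz
    have hpos : 0 < ‖jacobian f p‖ := norm_pos_iff.2 (jacobian_ne_zero hopen hf (hKΩ hp))
    rw [norm_div]
    exact ⟨(div_le_iff₀ hpos).2 (hVA f hf p hp z hz).1,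
      (le_div_iff₀ hpos).2 ((inv_mul_le_iff₀ hA).2 (hVA f hf p hp z hz).2)⟩
  refine ⟨⟨hd, fun u hu => ?_⟩, fun u h hu huh => ⟨?_, fun z hz => ?_⟩⟩
  · refine exists_subseq_tendstoLocallyUniformlyOn hopen (fun j => hd _ (hu j)) fun z hz => ?_
    obtain ⟨V, hV, A, -, hA⟩ := hbounds z hz
    exact ⟨V, hV, A, fun j w hw => (hA _ (hu j) w hw).1⟩
  · exact differentiableOn_of_tendstoLocallyUniformlyOn hopen huh
      (Eventually.of_forall fun j => hd _ (hu j))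
  · obtain ⟨V, hV, A, hA0, hA⟩ := hbounds z hz
    have hlim := (huh.tendsto_at hz).norm
    -- The uniform lower bound survives the pointwise limit, so no Hurwitz argument is needed.
    have hle : A⁻¹ ≤ ‖h z‖ :=
      ge_of_tendsto' hlim fun j => (hA _ (hu j) z (mem_of_mem_nhds hV)).2
    exact norm_pos_iff.1 ((inv_pos.2 hA0).trans_le hle)
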